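/- Let $n\ge 1$ be an integer and let $\delta\ge 0$, $B,C>0$ be real. Let $\mathcal M_{n,\delta}(B,C)$ be the (finite, non-empty) set of square matrices with entries in $\mathbb N=\{0,1,2,\dots\}$ and with $\lfloor n^\delta\rfloor+n$ rows and columns, whose first $\lfloor n^\delta\rfloor$ rows and columns have sum $\lfloor BCn\rfloor$ and whose last $n$ rows and columns have sum $\lfloor Cn\rfloor$. Let $X=(X_{ij})$ be uniformly distributed on $\mathcal M_{n,\delta}(B,C)$. For $\lambda>0$ let $\mathrm{Geom}(\lambda)$ be the law on $\mathbb N$ with mass $\frac{1}{1+\lambda}\bigl(\frac{\lambda}{1+\lambda}\bigr)^k$ at $k$, which has mean $\lambda$. Put $d_{TV}(\mu,\nu)=\sum_{k\in\mathbb N}|\mu(k)-\nu(k)|$ and $B_c=1+\sqrt{1+1/C}$. **Theorem 1.** Fix $\delta\ge 0$, $B,C>0$ and $\varepsilon>0$. The following hold for all $n\ge 1$, where the constants implied by $O(\cdot)$ depend only on $\delta,B,C,\varepsilon$ (and, in (iii) for $B>B_c$, on $M$). (i) [bottom right] If $0\le\delta\le1$ and $i,j>\lfloor n^\delta\rfloor$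 (for instance $i=j=n+1$), then $$d_{TV}\bigl(X_{ij},\mathrm{Geom}(C)\bigr)=O\bigl(n^{\delta-1}+n^{-1/2+\varepsilon}\bigr).$$ (ii) [sides] If $0<\delta\le1$, $B\ne B_c$, and exactly one of $i,j$ is at most $\lfloor n^\delta\rfloor$ (for instance $i=1$, $j=n+1$), then $$d_{TV}\bigl(X_{ij},\mathrm{Geom}(R)\bigr)=O\bigl(n^{\delta-1}+n^{-\delta/2+\varepsilon}\bigr),$$ where $R=BC$ if $B<B_c$ and $R=B_cC$ if $B>B_c$. (iii) [top left] If $1/2<\delta<1$, $B\ne B_c$, and $i,j\le\lfloor n^\delta\rfloor$ (for instance $i=j=1$), then $$d_{TV}\bigl(X_{ij},\mathrm{Geom}(R)\bigr)=O\bigl(n^{\delta-1}+n^{1/2-\delta+\varepsilon}\bigr),$$ where $R=\dfrac{B^2(1+C)}{(B_c-B)(B+B_c-2)}$ if $B<B_c$, and where, if $B>B_c$, $R=R_n>0$ is any number with $R=C(B-B_c)n^{1-\delta}+O(1)$, i.e. with $|R-C(B-B_c)n^{1-\delta}|\le M$ for a fixed constant $M$. -/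

import Mathlib

open MeasureTheory ProbabilityTheory

noncomputable section

namespace ContingencyTable

/-- The set of contingency tables (matrices of natural numbers) with row margins `r` and
column margins `c`. -/
def tables {p q : ℕ} (r : Fin p → ℕ) (c : Fin q → ℕ) : Set (Fin p → Fin q → ℕ) :=
  {A | (∀ i, ∑ j, A i j = r i) ∧ ∀ j, ∑ i, A i j = c j}

theorem tables_finite {p q : ℕ} (r : Fin p → ℕ) (c : Fin q → ℕ) : (tables r c).Finite := by
  refine Set.Finite.subset (Set.Finite.pi' fun i : Fin p =>
    Set.Finite.pi' fun _ : Fin q => Set.finite_Iic (r i)) ?_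
  intro A hA i j
  have h := Finset.single_le_sum (f := fun j => A i j) (fun _ _ => Nat.zero_le _)
    (Finset.mem_univ j)
  exact h.trans (hA.1 i).le

theorem tables_self_nonempty {p : ℕ} (r : Fin p → ℕ) : (tables r r).Nonempty := by
  refine ⟨fun i j => if i = j then r i else 0, fun i => ?_, fun j => ?_⟩ <;> simp

/-- The uniform probability measure on the contingency tables with margins `r` and `c`. -/
def uniformTable {p q : ℕ} (r : Fin p → ℕ) (c : Fin q → ℕ) : Measure (Fin p → Fin q → ℕ) :=
  uniformOn (tables r c)

theorem isProbabilityMeasure_uniformTable_self {p : ℕ} (r : Fin p → ℕ) :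
    IsProbabilityMeasure (uniformTable r r) :=
  isProbabilityMeasure_uniformOn (tables_finite r r) (tables_self_nonempty r)

/-- The number `⌊n ^ δ⌋` of special rows (and of special columns). -/
def numTop (n : ℕ) (δ : ℝ) : ℕ := ⌊(n : ℝ) ^ δ⌋₊

/-- The margin vector `(⌊BCn⌋, …, ⌊BCn⌋, ⌊Cn⌋, …, ⌊Cn⌋)`, with `⌊n ^ δ⌋` entries `⌊BCn⌋`
followed by `n` entries `⌊Cn⌋`. Indices are counted from `0`. -/
def margin (n : ℕ) (δ B C : ℝ) (i : Fin (numTop n δ + n)) : ℕ :=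
  if (i : ℕ) < numTop n δ then ⌊B * C * n⌋₊ else ⌊C * n⌋₊

/-- The probability mass function of the entry `X i j` of the uniform random table `X` whose
row margins and column margins are both `margin n δ B C`. -/
def entryMass (n : ℕ) (δ B C : ℝ) (i j : Fin (numTop n δ + n)) (k : ℕ) : ℝ :=
  (uniformTable (margin n δ B C) (margin n δ B C)).real {X | X i j = k}

/-- The probability mass function of the geometric distribution on `ℕ` with mean `l > 0`. -/
def geomMass (l : ℝ) (k : ℕ) : ℝ := 1 / (1 + l) * (l / (1 + l)) ^ k

/-- The total variation distance of two probability mass functions on `ℕ`, normalized as the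
full `ℓ¹` distance (without a factor `1 / 2`). -/
def dTV (μ ν : ℕ → ℝ) : ℝ := ∑' k, |μ k - ν k|

/-- The critical value `1 + √(1 + 1 / C)`. -/
def critB (C : ℝ) : ℝ := 1 + Real.sqrt (1 + 1 / C)

end ContingencyTable

end

noncomputable section

namespace ContingencyTable

/-- The excess of the entries of column `j` up to row `i` over those of column `k` before
row `i`. -/
def crystalHeight {p q : ℕ} (j k : Fin q) (T : Fin p → Fin q → ℕ) (i : Fin p) : ℤ :=
  ∑ l ∈ Finset.Iic i, (T l j : ℤ) - ∑ l ∈ Finset.Iio i, (T l k : ℤ)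

theorem exists_first_argmax {p : ℕ} [Nonempty (Fin p)] (h : Fin p → ℤ) :
    ∃ i₀, (∀ i, h i ≤ h i₀) ∧ ∀ i < i₀, h i < h i₀ := by
  obtain ⟨m, -, hm⟩ := Finset.exists_max_image Finset.univ h Finset.univ_nonempty
  have hne : (Finset.univ.filter fun i => h i = h m).Nonempty := ⟨m, by simp⟩
  refine ⟨(Finset.univ.filter fun i => h i = h m).min' hne, ?_, ?_⟩
  · have h1 := Finset.min'_mem _ hne
    rw [Finset.mem_filter] at h1
    intro i
    rw [h1.2]
    exact hm i (Finset.mem_univ _)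
  · intro i hi
    have h1 := Finset.min'_mem _ hne
    rw [Finset.mem_filter] at h1
    rw [h1.2]
    refine lt_of_le_of_ne (hm i (Finset.mem_univ _)) fun h2 => ?_
    exact absurd (Finset.min'_le _ i (by simp [h2])) (not_le.mpr hi)

/-- Move one unit from column `j` to column `k` in row `i₀`. -/
def moveUnit {p q : ℕ} (j k : Fin q) (i₀ : Fin p) (T : Fin p → Fin q → ℕ) : Fin p → Fin q → ℕ :=
  Function.update T i₀
    (Function.update (Function.update (T i₀) j (T i₀ j - 1)) k (T i₀ k + 1))

theorem moveUnit_left {p q : ℕ} {j k : Fin q} (hjk : j ≠ k) {i₀ : Fin p}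
    {T : Fin p → Fin q → ℕ} (hT : 1 ≤ T i₀ j) (l : Fin p) :
    (moveUnit j k i₀ T l j : ℤ) = T l j - if l = i₀ then 1 else 0 := by
  by_cases h : l = i₀
  · subst h
    simp [moveUnit, hjk, hT]
  · simp [moveUnit, h]

theorem moveUnit_right {p q : ℕ} {j k : Fin q} {i₀ : Fin p} {T : Fin p → Fin q → ℕ}
    (l : Fin p) :
    (moveUnit j k i₀ T l k : ℤ) = T l k + if l = i₀ then 1 else 0 := by
  by_cases h : l = i₀
  · subst h
    simp [moveUnit]
  · simp [moveUnit, h]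

theorem moveUnit_other {p q : ℕ} {j k c : Fin q} {i₀ : Fin p} {T : Fin p → Fin q → ℕ}
    (hj : c ≠ j) (hk : c ≠ k) (l : Fin p) : moveUnit j k i₀ T l c = T l c := by
  by_cases h : l = i₀
  · subst h
    simp [moveUnit, hj, hk]
  · simp [moveUnit, h]

theorem sum_moveUnit_row {p q : ℕ} {j k : Fin q} (hjk : j ≠ k) {i₀ : Fin p}
    {T : Fin p → Fin q → ℕ} (hT : 1 ≤ T i₀ j) (l : Fin p) :
    ∑ c, moveUnit j k i₀ T l c = ∑ c, T l c := by
  have key : ∀ c, (moveUnit j k i₀ T l c : ℤ) = T l c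
      + ((if c = k then (if l = i₀ then 1 else 0) else 0)
        - if c = j then (if l = i₀ then 1 else 0) else 0) := by
    intro c
    by_cases hj : c = j
    · subst hj
      rw [moveUnit_left hjk hT]
      simp [hjk]
      ring
    · by_cases hk : c = k
      · subst hk
        rw [moveUnit_right]
        simp [hj]
      · rw [moveUnit_other hj hk]
        simp [hj, hk]
  have : ((∑ c, moveUnit j k i₀ T l c : ℕ) : ℤ) = ((∑ c, T l c : ℕ) : ℤ) := by
    push_cast
    simp only [key, Finset.sum_add_distrib, Finset.sum_sub_distrib]
    simp
  exact_mod_cast this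

theorem crystalHeight_moveUnit {p q : ℕ} {j k : Fin q} (hjk : j ≠ k) {i₀ : Fin p}
    {T : Fin p → Fin q → ℕ} (hT : 1 ≤ T i₀ j) (i : Fin p) :
    crystalHeight j k (moveUnit j k i₀ T) i =
      crystalHeight j k T i - (if i₀ ≤ i then 1 else 0) - if i₀ < i then 1 else 0 := by
  simp only [crystalHeight, moveUnit_left hjk hT, moveUnit_right, Finset.sum_add_distrib,
    Finset.sum_sub_distrib, Finset.sum_ite_eq', Finset.mem_Iic, Finset.mem_Iio]
  ring

theorem crystalHeight_last {p q : ℕ} (j k : Fin q) (T : Fin (p + 1) → Fin q → ℕ) :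
    ∑ i, (T i j : ℤ) - ∑ i, (T i k : ℤ) ≤ crystalHeight j k T (Fin.last p) := by
  have h1 : Finset.Iic (Fin.last p) = Finset.univ := by
    ext i; simp [Fin.le_last]
  rw [crystalHeight, h1]
  have : ∑ l ∈ Finset.Iio (Fin.last p), (T l k : ℤ) ≤ ∑ i, (T i k : ℤ) :=
    Finset.sum_le_sum_of_subset_of_nonneg (Finset.subset_univ _) (by intros; positivity)
  linarith

/-- The first maximizer of the height has a positive entry in column `j`, if column `j` has a
larger sum than column `k`. -/
theorem pos_of_first_argmax {p q : ℕ} {j k : Fin q} {T : Fin (p + 1) → Fin q → ℕ}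
    (hsum : ∑ i, T i k < ∑ i, T i j) {i₀ : Fin (p + 1)}
    (hmax : ∀ i, crystalHeight j k T i ≤ crystalHeight j k T i₀)
    (hfirst : ∀ i < i₀, crystalHeight j k T i < crystalHeight j k T i₀) : 1 ≤ T i₀ j := by
  by_contra hT
  have h0 : T i₀ j = 0 := by omega
  have hI : Finset.Iic i₀ = insert i₀ (Finset.Iio i₀) := by
    ext i; simp [le_iff_eq_or_lt]
  rcases Fin.eq_zero_or_eq_succ i₀ with h | ⟨i', h⟩
  · have h1 := hmax (Fin.last p)
    have h2 := crystalHeight_last j k T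
    have h3 : crystalHeight j k T i₀ ≤ 0 := by
      have : Finset.Iio i₀ = ∅ := by
        ext i; simp [h]
      simp [crystalHeight, hI, this, h0]
    have h4 : (∑ i, (T i k : ℤ)) < ∑ i, (T i j : ℤ) := by exact_mod_cast hsum
    linarith
  · have h1 := hfirst i'.castSucc (by rw [h]; exact Fin.castSucc_lt_succ)
    have hJ : Finset.Iio i₀ = Finset.Iic i'.castSucc := by
      ext i
      simp [h, Fin.lt_def, Fin.le_def]
    have h2 : ∑ l ∈ Finset.Iio i'.castSucc, (T l k : ℤ) ≤ ∑ l ∈ Finset.Iio i₀, (T l k : ℤ) := by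
      refine Finset.sum_le_sum_of_subset_of_nonneg ?_ (by intros; positivity)
      rw [hJ]
      exact fun i hi => by
        simp only [Finset.mem_Iio, Finset.mem_Iic] at hi ⊢
        exact hi.le
    have h3 : ∑ l ∈ Finset.Iic i₀, (T l j : ℤ) = ∑ l ∈ Finset.Iic i'.castSucc, (T l j : ℤ) := by
      rw [hI, Finset.sum_insert (by simp), h0, hJ]
      simp
    simp only [crystalHeight] at h1
    rw [h3] at h1
    linarith

/-- Moving a unit from a column to a column with a smaller sum does not decrease the number of
tables. -/
theorem ncard_tables_le_of_move {p q : ℕ} (r : Fin p → ℕ) (c : Fin q → ℕ) {j k : Fin q}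
    (hlt : c k < c j) :
    (tables r c).ncard ≤
      (tables r (Function.update (Function.update c j (c j - 1)) k (c k + 1))).ncard := by
  have hjk : j ≠ k := by rintro rfl; exact lt_irrefl _ hlt
  rcases p with _ | p
  · have : tables r c = ∅ := by
      ext T
      simp only [tables, Set.mem_ofPred_eq, Set.mem_empty_iff_false, iff_false, not_and]
      intro _ h
      have := h j
      simp at this
      omega
    simp [this]
  choose I hmax hfirst using fun T : Fin (p + 1) → Fin q → ℕ =>
    exists_first_argmax (crystalHeight j k T)
  have hpos : ∀ T ∈ tables r c, 1 ≤ T (I T) j := by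
    intro T hT
    exact pos_of_first_argmax (by rw [hT.2, hT.2]; exact hlt) (hmax T) (hfirst T)
  refine Set.ncard_le_ncard_of_injOn (fun T => moveUnit j k (I T) T) ?_ ?_ (tables_finite _ _)
  · intro T hT
    have h1 := hpos T hT
    refine ⟨fun i => by rw [sum_moveUnit_row hjk h1]; exact hT.1 i, fun d => ?_⟩
    have hd := hT.2 d
    by_cases hj : d = j
    · subst hj
      have : ((∑ i, moveUnit d k (I T) T i d : ℕ) : ℤ) = c d - 1 := by
        push_cast
        simp only [moveUnit_left hjk h1, Finset.sum_sub_distrib, ← hd]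
        simp
      simp [hjk]
      omega
    · by_cases hk : d = k
      · subst hk
        have : ((∑ i, moveUnit j d (I T) T i d : ℕ) : ℤ) = c d + 1 := by
          push_cast
          simp only [moveUnit_right, Finset.sum_add_distrib, ← hd]
          simp
        simp
        omega
      · simp [moveUnit_other hj hk, hj, hk, hd]
  · intro T hT T' hT' heq
    have key : ∀ S ∈ tables r c, ∀ i,
        crystalHeight j k (moveUnit j k (I S) S) i ≤
          crystalHeight j k (moveUnit j k (I S) S) (I S) ∧
        (I S < i → crystalHeight j k (moveUnit j k (I S) S) i <
          crystalHeight j k (moveUnit j k (I S) S) (I S)) := by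
      intro S hS i
      simp only [crystalHeight_moveUnit hjk (hpos S hS)]
      have h1 := hmax S i
      have h2 := hfirst S i
      rcases lt_trichotomy i (I S) with h | h | h
      · have := h2 h
        simp [h.not_ge, h.not_gt]
        omega
      · simp [h]
      · simp [h, h.le]
        omega
    have hI : I T = I T' := by
      have heq' : moveUnit j k (I T) T = moveUnit j k (I T') T' := heq
      have k1 := key T hT
      have k2 := key T' hT'
      rw [← heq'] at k2
      rcases lt_trichotomy (I T) (I T') with h | h | h
      · exact absurd ((k1 _).2 h) (not_lt.mpr (k2 _).1)
      · exact h
      · exact absurd ((k2 _).2 h) (not_lt.mpr (k1 _).1)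
    funext l d
    have h1 : moveUnit j k (I T) T l d = moveUnit j k (I T') T' l d := by
      rw [show moveUnit j k (I T) T = moveUnit j k (I T') T' from heq]
    by_cases hj : d = j
    · subst hj
      have a := moveUnit_left hjk (hpos T hT) l
      have b := moveUnit_left hjk (hpos T' hT') l
      rw [h1, b, hI] at a
      omega
    · by_cases hk : d = k
      · subst hk
        have a := moveUnit_right (j := j) (k := d) (i₀ := I T) (T := T) l
        have b := moveUnit_right (j := j) (k := d) (i₀ := I T') (T := T') l
        rw [h1, b, hI] at a
        omega
      · rwa [moveUnit_other hj hk, moveUnit_other hj hk] at h1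

/-- Among the column margins with prescribed sums over the groups given by `g`, those which are
constant on the groups have the largest number of tables. -/
theorem ncard_tables_le_of_column_groups {p q : ℕ} (r : Fin p → ℕ) (g : Fin q → Bool)
    (ρ : Bool → ℕ) (c : Fin q → ℕ)
    (hc : ∀ b, ∑ j with g j = b, c j = ∑ j with g j = b, ρ (g j)) :
    (tables r c).ncard ≤ (tables r fun j => ρ (g j)).ncard := by
  induction hN : ∑ j, Int.natAbs ((c j : ℤ) - ρ (g j)) using Nat.strong_induction_on
    generalizing c with
  | _ N ih =>
    by_cases hcc : c = fun j => ρ (g j)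
    · rw [hcc]
    · obtain ⟨j₀, hj₀⟩ := Function.ne_iff.mp hcc
      have hup : ∃ j, g j = g j₀ ∧ ρ (g j) < c j := by
        by_contra! h
        have := (Finset.sum_eq_sum_iff_of_le (s := Finset.univ.filter fun j => g j = g j₀)
          (f := c) (g := fun j => ρ (g j)) (fun j hj => h j (by simpa using hj))).mp (hc _) j₀
          (by simp)
        exact hj₀ this
      have hdown : ∃ k, g k = g j₀ ∧ c k < ρ (g k) := by
        by_contra! h
        have := (Finset.sum_eq_sum_iff_of_le (s := Finset.univ.filter fun j => g j = g j₀)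
          (f := fun j => ρ (g j)) (g := c) (fun j hj => h j (by simpa using hj))).mp (hc _).symm j₀
          (by simp)
        exact hj₀ this.symm
      obtain ⟨j, hgj, hj⟩ := hup
      obtain ⟨k, hgk, hk⟩ := hdown
      have hlt : c k < c j := by
        rw [hgj] at hj; rw [hgk] at hk; omega
      have hjk : j ≠ k := by rintro rfl; exact lt_irrefl _ hlt
      refine (ncard_tables_le_of_move r c hlt).trans ?_
      set c' := Function.update (Function.update c j (c j - 1)) k (c k + 1) with hc'
      have hval : ∀ l, (c' l : ℤ) = c l + ((if l = k then 1 else 0) - if l = j then 1 else 0) := by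
        intro l
        rw [hc']
        by_cases h1 : l = k
        · subst h1
          simp [hjk.symm]
        · by_cases h2 : l = j
          · subst h2
            simp [h1]
            omega
          · simp [h1, h2]
      refine ih _ ?_ c' ?_ rfl
      · rw [← hN]
        refine Finset.sum_lt_sum (fun l _ => ?_) ⟨j, Finset.mem_univ _, ?_⟩
        · rw [hval]
          by_cases h1 : l = k
          · subst h1
            simp [hjk.symm]
            omega
          · by_cases h2 : l = j
            · subst h2
              simp [h1]
              omega
            · simp [h1, h2]
        · rw [hval]
          simp [hjk]
          omega
      · intro b
        rw [← hc b]
        have : ((∑ l with g l = b, c' l : ℕ) : ℤ) = ((∑ l with g l = b, c l : ℕ) : ℤ) := by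
          push_cast
          simp only [hval, Finset.sum_add_distrib, Finset.sum_sub_distrib, Finset.sum_ite_eq',
            Finset.mem_filter, Finset.mem_univ, true_and, hgj, hgk]
          ring
        exact_mod_cast this

theorem ncard_tables_swap {p q : ℕ} (r : Fin p → ℕ) (c : Fin q → ℕ) :
    (tables r c).ncard ≤ (tables c r).ncard := by
  refine Set.ncard_le_ncard_of_injOn (fun T j i => T i j) ?_ ?_ (tables_finite _ _)
  · intro T hT
    exact ⟨hT.2, hT.1⟩
  · intro T _ T' _ h
    funext i j
    exact congrFun (congrFun h j) i

theorem ncard_tables_le_of_groups {p : ℕ} (g : Fin p → Bool) (ρ : Bool → ℕ) (r c : Fin p → ℕ)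
    (hr : ∀ b, ∑ j with g j = b, r j = ∑ j with g j = b, ρ (g j))
    (hc : ∀ b, ∑ j with g j = b, c j = ∑ j with g j = b, ρ (g j)) :
    (tables r c).ncard ≤ (tables (fun j => ρ (g j)) fun j => ρ (g j)).ncard :=
  ((ncard_tables_le_of_column_groups r g ρ c hc).trans (ncard_tables_swap _ _)).trans
    (ncard_tables_le_of_column_groups _ g ρ r hr)

theorem card_functions_with_sum {α : Type*} [Fintype α] [DecidableEq α] (a : ℕ) :
    {T : α → ℕ | ∑ x, T x = a}.ncard = (Fintype.card α).multichoose a := by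
  have h := Finset.card_finsuppAntidiag_nat_eq_multichoose (s := (Finset.univ : Finset α)) a
  rw [Finset.card_univ] at h
  rw [← h, ← Set.ncard_coe_finset]
  refine Set.ncard_congr (fun T _ => Finsupp.equivFunOnFinite.symm T) ?_ ?_ ?_
  · intro T hT
    simpa using hT
  · intro T T' _ _ h
    simpa using h
  · intro f hf
    refine ⟨f, ?_, ?_⟩
    · simpa using hf
    · ext; simp

theorem exp_one_mul_pow_le (n : ℕ) :
    Real.exp 1 * (n : ℝ) ^ (n + 1) ≤ ((n : ℝ) + 1) ^ (n + 1) := by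
  rcases Nat.eq_zero_or_pos n with rfl | hn
  · simp
  have hn' : (0 : ℝ) < n := by exact_mod_cast hn
  have h1 : Real.exp (1 / (n + 1)) ≤ (n + 1) / n := by
    have := Real.add_one_le_exp (-(1 / ((n : ℝ) + 1)))
    have h2 : -(1 / ((n : ℝ) + 1)) + 1 = n / (n + 1) := by field_simp; ring
    rw [h2, Real.exp_neg] at this
    have h3 := inv_anti₀ (by positivity) this
    rwa [inv_inv, inv_div] at h3
  have h2 : Real.exp 1 ≤ ((n + 1) / n) ^ (n + 1) := by
    calc Real.exp 1 = Real.exp (1 / (n + 1)) ^ (n + 1) := by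
          rw [← Real.exp_nat_mul]; congr 1; push_cast; field_simp
      _ ≤ _ := by gcongr
  rwa [div_pow, le_div_iff₀ (by positivity)] at h2

theorem factorial_le_exp_mul_of_pos {n : ℕ} (hn : 1 ≤ n) :
    (n.factorial : ℝ) ≤ Real.exp 1 * n * ((n : ℝ) / Real.exp 1) ^ n := by
  have he := Real.exp_pos 1
  induction n, hn using Nat.le_induction with
  | base => simp
  | succ n hn ih =>
    have hn' : (0 : ℝ) < n := by exact_mod_cast hn
    rw [Nat.factorial_succ]
    push_cast
    calc ((n : ℝ) + 1) * n.factorial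
        ≤ (n + 1) * (Real.exp 1 * n * ((n : ℝ) / Real.exp 1) ^ n) := by gcongr
      _ = (n + 1) * (Real.exp 1 * (n : ℝ) ^ (n + 1)) / Real.exp 1 ^ n := by
          rw [div_pow]; field_simp; ring
      _ ≤ (n + 1) * ((n : ℝ) + 1) ^ (n + 1) / Real.exp 1 ^ n := by
          gcongr; exact exp_one_mul_pow_le n
      _ = _ := by rw [div_pow, pow_succ (Real.exp 1)]; field_simp

theorem factorial_le_exp_mul (n : ℕ) :
    (n.factorial : ℝ) ≤ Real.exp 1 * (n + 1) * ((n : ℝ) / Real.exp 1) ^ n := by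
  rcases Nat.eq_zero_or_pos n with rfl | hn
  · simp
  · refine (factorial_le_exp_mul_of_pos hn).trans ?_
    gcongr
    linarith

theorem pow_div_exp_le_factorial (n : ℕ) : ((n : ℝ) / Real.exp 1) ^ n ≤ n.factorial := by
  have h := Real.pow_div_factorial_le_exp (n : ℝ) (Nat.cast_nonneg n) n
  have h2 : Real.exp n = Real.exp 1 ^ n := by rw [← Real.exp_nat_mul]; simp
  rw [h2, div_le_iff₀ (by positivity)] at h
  rw [div_pow, div_le_iff₀ (by positivity)]
  linarith

/-- An entropy lower bound for the number of weak compositions. -/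
theorem pow_le_multichoose_mul {K : ℕ} (hK : 1 ≤ K) (a : ℕ) :
    ((K : ℝ) + a) ^ (K + a) ≤ K.multichoose a *
      (Real.exp 1 ^ 2 * (2 * (K + a) * (a + 1)) * ((K : ℝ) ^ K * (a : ℝ) ^ a)) := by
  have hK' : (1 : ℝ) ≤ K := by exact_mod_cast hK
  have he := Real.exp_pos 1
  have h1 : ((K + a).factorial : ℝ) * K = K.multichoose a * ((K + a) * (a.factorial * K.factorial)) := by
    obtain ⟨k, rfl⟩ : ∃ k, K = k + 1 := ⟨K - 1, by omega⟩
    have h := Nat.add_choose_mul_factorial_mul_factorial k a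
    have e1 : (k + 1).multichoose a = (k + a).choose a := by
      rw [Nat.multichoose_eq]; congr 1; omega
    rw [e1, show k + 1 + a = (k + a) + 1 by ring, Nat.factorial_succ, Nat.factorial_succ, ← h]
    push_cast
    ring
  have h2 := pow_div_exp_le_factorial (K + a)
  have h3 := factorial_le_exp_mul a
  have h4 := factorial_le_exp_mul_of_pos hK
  push_cast at h2
  have h5 : (((K : ℝ) + a) / Real.exp 1) ^ (K + a) * K ≤ K.multichoose a * ((K + a) *
      ((Real.exp 1 * (a + 1) * ((a : ℝ) / Real.exp 1) ^ a) *
        (Real.exp 1 * K * ((K : ℝ) / Real.exp 1) ^ K))) := by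
    refine (mul_le_mul_of_nonneg_right h2 (by positivity)).trans ?_
    rw [h1]
    gcongr
  have h6 : ((K : ℝ) + a) ^ (K + a) * K ≤ (K.multichoose a *
      (Real.exp 1 ^ 2 * ((K + a) * (a + 1)) * ((K : ℝ) ^ K * (a : ℝ) ^ a))) * K := by
    have := mul_le_mul_of_nonneg_right h5 (by positivity : 0 ≤ Real.exp 1 ^ (K + a))
    calc ((K : ℝ) + a) ^ (K + a) * K
        = (((K : ℝ) + a) / Real.exp 1) ^ (K + a) * K * Real.exp 1 ^ (K + a) := by
          rw [div_pow]; field_simp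
      _ ≤ _ := this
      _ = _ := by rw [div_pow, div_pow, pow_add]; field_simp
  have h7 := le_of_mul_le_mul_right h6 (by positivity)
  refine h7.trans ?_
  gcongr
  nlinarith

/-- A lower bound for the point masses of the negative binomial distribution near its mean. -/
theorem negBinomial_lower_bound {K : ℕ} (hK : 1 ≤ K) (a : ℕ) {z : ℝ} (hz : 0 < z)
    (ha : |(a : ℝ) - K * z| ≤ 1) :
    Real.exp (-(4 + 1 / (K * z))) / (2 * (K + a) * (a + 1)) ≤
      K.multichoose a * ((1 / (1 + z)) ^ K * (z / (1 + z)) ^ a) := by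
  have hK' : (1 : ℝ) ≤ K := by exact_mod_cast hK
  have he := Real.exp_pos 1
  obtain ⟨t, ht⟩ : ∃ t : ℝ, t = a - K * z := ⟨_, rfl⟩
  have hat : (a : ℝ) = K * z + t := by rw [ht]; ring
  rw [← ht, abs_le] at ha
  have hKz : 0 < K * z := by positivity
  have ha0 : (0 : ℝ) ≤ a := by positivity
  have h1 : (a : ℝ) ^ a ≤ (K * z) ^ a * Real.exp (1 + 1 / (K * z)) := by
    have hb : (a : ℝ) ≤ K * z * Real.exp (t / (K * z)) := by
      have := Real.add_one_le_exp (t / (K * z))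
      calc (a : ℝ) = K * z * (t / (K * z) + 1) := by rw [hat]; field_simp; ring
        _ ≤ _ := by gcongr
    calc (a : ℝ) ^ a ≤ (K * z * Real.exp (t / (K * z))) ^ a := by gcongr
      _ = (K * z) ^ a * Real.exp (a * (t / (K * z))) := by
          rw [mul_pow, ← Real.exp_nat_mul]
      _ ≤ _ := by
          gcongr
          have : (a : ℝ) * (t / (K * z)) = t + t ^ 2 / (K * z) := by rw [hat]; field_simp
          rw [this]
          have : t ^ 2 ≤ 1 := by nlinarith
          have := ha.2
          gcongr
  have h2 : ((K : ℝ) * (1 + z)) ^ (K + a) ≤ (K + a) ^ (K + a) * Real.exp 1 := by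
    have hb : (K : ℝ) * (1 + z) ≤ (K + a) * Real.exp (-t / (K + a)) := by
      have := Real.add_one_le_exp (-t / (K + a : ℝ))
      calc (K : ℝ) * (1 + z) = (K + a) * (-t / (K + a) + 1) := by
              have : ((K : ℝ) + a) * (-t / (K + a) + 1) = -t + (K + a) := by field_simp
              rw [this, hat]; ring
        _ ≤ _ := by gcongr
    calc ((K : ℝ) * (1 + z)) ^ (K + a) ≤ ((K + a) * Real.exp (-t / (K + a))) ^ (K + a) := by gcongr
      _ = (K + a) ^ (K + a) * Real.exp (-t) := by
          rw [mul_pow, ← Real.exp_nat_mul]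
          congr 2
          push_cast
          field_simp
      _ ≤ _ := by
          gcongr
          linarith
  have h3 := pow_le_multichoose_mul hK a
  have h4 : ((K : ℝ) * (1 + z)) ^ (K + a) ≤ K.multichoose a *
      (Real.exp 1 ^ 2 * (2 * (K + a) * (a + 1)) * ((K : ℝ) ^ K * ((K * z) ^ a *
        Real.exp (1 + 1 / (K * z))))) * Real.exp 1 := by
    refine h2.trans ?_
    gcongr
    exact h3.trans (by gcongr)
  rw [div_le_iff₀ (by positivity), Real.exp_neg, inv_le_iff_one_le_mul₀ (Real.exp_pos _)]
  have e4 : Real.exp (4 + 1 / (K * z)) =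
      Real.exp 1 ^ 2 * Real.exp (1 + 1 / (K * z)) * Real.exp 1 := by
    rw [← Real.exp_nat_mul, ← Real.exp_add, ← Real.exp_add]
    congr 1
    push_cast
    ring
  have hP : 0 < ((K : ℝ) * (1 + z)) ^ (K + a) := by positivity
  refine le_of_mul_le_mul_left ?_ hP
  rw [mul_one]
  refine h4.trans (le_of_eq ?_)
  rw [e4, div_pow, div_pow, mul_pow, mul_pow, one_pow, pow_add, pow_add]
  field_simp

theorem sum_prod_le_prod_tsum {ι : Type*} [Fintype ι] [DecidableEq ι] (M : Finset (ι → ℕ))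
    (g : ι → ℕ → ℝ) (hg : ∀ c k, 0 ≤ g c k) (hs : ∀ c, Summable (g c)) :
    ∑ T ∈ M, ∏ c, g c (T c) ≤ ∏ c, ∑' k, g c k := by
  have hsub : M ⊆ Fintype.piFinset fun c => Finset.range (M.sup (fun T => T c) + 1) := by
    intro T hT
    rw [Fintype.mem_piFinset]
    intro c
    rw [Finset.mem_range, Nat.lt_succ_iff]
    exact Finset.le_sup (f := fun T : ι → ℕ => T c) hT
  calc ∑ T ∈ M, ∏ c, g c (T c)
      ≤ ∑ T ∈ Fintype.piFinset fun c => Finset.range (M.sup (fun T => T c) + 1),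
          ∏ c, g c (T c) :=
        Finset.sum_le_sum_of_subset_of_nonneg hsub
          fun T _ _ => Finset.prod_nonneg fun c _ => hg c _
    _ = ∏ c, ∑ k ∈ Finset.range (M.sup (fun T => T c) + 1), g c k :=
        (Finset.prod_univ_sum _ _).symm
    _ ≤ _ := Finset.prod_le_prod (fun c _ => Finset.sum_nonneg fun k _ => hg c k)
        fun c _ => (hs c).sum_le_tsum _ fun k _ => hg c k

theorem geomMass_nonneg {z : ℝ} (hz : 0 ≤ z) (k : ℕ) : 0 ≤ geomMass z k := by
  unfold geomMass
  positivity

theorem hasSum_geomMass {z : ℝ} (hz : 0 ≤ z) : HasSum (geomMass z) 1 := by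
  have h1 : z / (1 + z) < 1 := by
    rw [div_lt_one (by positivity)]; linarith
  have h := (hasSum_geometric_of_lt_one (by positivity) h1).mul_left (1 / (1 + z))
  have e1 : 1 - z / (1 + z) = 1 / (1 + z) := by field_simp; ring
  have e2 : 1 / (1 + z) * (1 - z / (1 + z))⁻¹ = 1 := by rw [e1]; field_simp
  rwa [e2] at h

theorem summable_geomMass_mul {z : ℝ} (hz : 0 ≤ z) {f : ℕ → ℝ} (hf : ∀ k, |f k| ≤ 1) :
    Summable fun k => geomMass z k * f k := by
  refine Summable.of_norm_bounded (hasSum_geomMass hz).summable fun k => ?_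
  rw [Real.norm_eq_abs, abs_mul, abs_of_nonneg (geomMass_nonneg hz k)]
  exact mul_le_of_le_one_right (geomMass_nonneg hz k) (hf k)

theorem abs_tsum_geomMass_mul_le {z : ℝ} (hz : 0 ≤ z) {f : ℕ → ℝ} (hf : ∀ k, |f k| ≤ 1) :
    |∑' k, geomMass z k * f k| ≤ 1 := by
  have h := tsum_of_norm_bounded (f := fun k => geomMass z k * f k) (hasSum_geomMass hz)
    fun k => by
      rw [Real.norm_eq_abs, abs_mul, abs_of_nonneg (geomMass_nonneg hz k)]
      exact mul_le_of_le_one_right (geomMass_nonneg hz k) (hf k)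
  rwa [Real.norm_eq_abs] at h

theorem exp_le_one_add_add_sq {x : ℝ} (hx : |x| ≤ 1) : Real.exp x ≤ 1 + x + x ^ 2 := by
  have := (abs_le.mp (Real.abs_exp_sub_one_sub_id_le hx)).2
  linarith

/-- The exponential moments of a bounded centred function of a geometric random variable. -/
theorem geomMass_exp_moment {z : ℝ} (hz : 0 ≤ z) {f : ℕ → ℝ} (hf : ∀ k, |f k| ≤ 1) {s : ℝ}
    (hs : 0 ≤ s) (hs' : s ≤ 1 / 2) :
    (Summable fun k => geomMass z k * Real.exp (s * (f k - ∑' l, geomMass z l * f l))) ∧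
      ∑' k, geomMass z k * Real.exp (s * (f k - ∑' l, geomMass z l * f l)) ≤
        Real.exp (4 * s ^ 2) := by
  set m := ∑' l, geomMass z l * f l with hm
  have hm1 := abs_tsum_geomMass_mul_le hz hf
  rw [← hm] at hm1
  have hbound : ∀ k, geomMass z k * Real.exp (s * (f k - m)) ≤
      geomMass z k * (1 - s * m + 4 * s ^ 2) + s * (geomMass z k * f k) := by
    intro k
    have h1 : |f k - m| ≤ 2 := (abs_sub _ _).trans (by linarith [hf k])
    have h2 : |s * (f k - m)| ≤ 1 := by
      rw [abs_mul, abs_of_nonneg hs]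
      nlinarith [abs_nonneg (f k - m)]
    have h3 := exp_le_one_add_add_sq h2
    have h4 : (f k - m) ^ 2 ≤ 4 := by
      rw [← sq_abs]
      nlinarith [abs_nonneg (f k - m)]
    have h5 : (s * (f k - m)) ^ 2 ≤ 4 * s ^ 2 := by
      rw [mul_pow]
      nlinarith [sq_nonneg s]
    have h6 : Real.exp (s * (f k - m)) ≤ (1 - s * m + 4 * s ^ 2) + s * f k := by linarith
    have := mul_le_mul_of_nonneg_left h6 (geomMass_nonneg hz k)
    linarith
  have hsum : HasSum (fun k => geomMass z k * (1 - s * m + 4 * s ^ 2) + s * (geomMass z k * f k))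
      (1 * (1 - s * m + 4 * s ^ 2) + s * m) :=
    ((hasSum_geomMass hz).mul_right _).add ((summable_geomMass_mul hz hf).hasSum.mul_left s)
  have hsummable : Summable fun k => geomMass z k * Real.exp (s * (f k - m)) :=
    Summable.of_nonneg_of_le
      (fun k => mul_nonneg (geomMass_nonneg hz k) (Real.exp_pos _).le) hbound hsum.summable
  refine ⟨hsummable, ?_⟩
  refine (hsummable.tsum_le_tsum hbound hsum.summable).trans ?_
  rw [hsum.tsum_eq]
  have := Real.add_one_le_exp (4 * s ^ 2)
  linarith

/-- A quantitative form of superadditivity of relative entropy combined with Pinsker's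
inequality, for a family on which the product of geometric weights is constant. -/
theorem mean_sub_le_of_constant_weight {ι : Type*} [Fintype ι] [DecidableEq ι]
    {M : Finset (ι → ℕ)} (hM : M.Nonempty) {Z : ι → ℝ} (hZ : ∀ c, 0 ≤ Z c) {W : ℝ} (hW0 : 0 < W)
    (hW : ∀ T ∈ M, ∏ c, geomMass (Z c) (T c) = W) (S : Finset ι) {z : ℝ} (hS : ∀ c ∈ S, Z c = z)
    {f : ℕ → ℝ} (hf : ∀ k, |f k| ≤ 1) {E : ℝ} (hE : ∀ c ∈ S, ∑ T ∈ M, f (T c) = M.card * E)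
    {s : ℝ} (hs : 0 ≤ s) (hs' : s ≤ 1 / 2) :
    s * S.card * (E - ∑' k, geomMass z k * f k) ≤ 4 * s ^ 2 * S.card - Real.log (M.card * W) := by
  set m := ∑' k, geomMass z k * f k with hm
  have hMc : (0 : ℝ) < M.card := by exact_mod_cast hM.card_pos
  set X : (ι → ℕ) → ℝ := fun T => s * ∑ c ∈ S, (f (T c) - m) with hX
  set a := s * S.card * (E - m) with ha
  have hXsum : ∑ T ∈ M, X T = M.card * a := by
    simp only [hX]
    rw [← Finset.mul_sum, Finset.sum_comm]
    have : ∀ c ∈ S, ∑ T ∈ M, (f (T c) - m) = M.card * (E - m) := by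
      intro c hc
      rw [Finset.sum_sub_distrib, hE c hc]
      simp
      ring
    rw [Finset.sum_congr rfl this]
    simp [ha]
    ring
  have hlow : M.card * Real.exp a ≤ ∑ T ∈ M, Real.exp (X T) := by
    have h1 : ∀ T ∈ M, Real.exp a * (X T - a + 1) ≤ Real.exp (X T) := by
      intro T _
      have := Real.add_one_le_exp (X T - a)
      calc Real.exp a * (X T - a + 1) ≤ Real.exp a * Real.exp (X T - a) := by gcongr
        _ = _ := by rw [← Real.exp_add]; congr 1; ring
    have h2 := Finset.sum_le_sum h1
    rw [← Finset.mul_sum, Finset.sum_add_distrib, Finset.sum_sub_distrib, hXsum] at h2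
    simp at h2
    linarith
  have hup : ∑ T ∈ M, W * Real.exp (X T) ≤ Real.exp (4 * s ^ 2 * S.card) := by
    have hgc : ∀ c, (Summable fun k => geomMass (Z c) k *
          (if c ∈ S then Real.exp (s * (f k - m)) else 1)) ∧
        ∑' k, geomMass (Z c) k * (if c ∈ S then Real.exp (s * (f k - m)) else 1) ≤
          if c ∈ S then Real.exp (4 * s ^ 2) else 1 := by
      intro c
      by_cases hc : c ∈ S
      · simp only [hc, if_true, hS c hc]
        have hz : 0 ≤ z := hS c hc ▸ hZ c
        exact geomMass_exp_moment hz hf hs hs'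
      · simp only [hc, if_false, mul_one]
        exact ⟨(hasSum_geomMass (hZ c)).summable, (hasSum_geomMass (hZ c)).tsum_eq.le⟩
    have hgn : ∀ c k, 0 ≤ geomMass (Z c) k *
          (if c ∈ S then Real.exp (s * (f k - m)) else 1) := by
      intro c k
      refine mul_nonneg (geomMass_nonneg (hZ c) k) ?_
      split_ifs
      exacts [(Real.exp_pos _).le, zero_le_one]
    have h1 := sum_prod_le_prod_tsum M (fun c k => geomMass (Z c) k *
          (if c ∈ S then Real.exp (s * (f k - m)) else 1)) hgn fun c => (hgc c).1
    have h2 : ∀ T ∈ M, W * Real.exp (X T) = ∏ c, geomMass (Z c) (T c) *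
          (if c ∈ S then Real.exp (s * (f (T c) - m)) else 1) := by
      intro T hT
      rw [Finset.prod_mul_distrib, hW T hT, Finset.prod_ite_mem, Finset.univ_inter,
        ← Real.exp_sum, ← Finset.mul_sum]
    rw [Finset.sum_congr rfl h2]
    refine h1.trans ((Finset.prod_le_prod (fun c _ => tsum_nonneg (hgn c))
      fun c _ => (hgc c).2).trans (le_of_eq ?_))
    rw [Finset.prod_ite_mem, Finset.univ_inter, Finset.prod_const, ← Real.exp_nat_mul]
    congr 1
    ring
  rw [← Finset.mul_sum] at hup
  have h3 : (M.card * W) * Real.exp a ≤ Real.exp (4 * s ^ 2 * S.card) := by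
    refine le_trans ?_ hup
    have := mul_le_mul_of_nonneg_left hlow hW0.le
    linarith
  have h4 := Real.log_le_log (by positivity) h3
  rw [Real.log_mul (by positivity) (Real.exp_pos _).ne', Real.log_exp, Real.log_exp] at h4
  linarith

theorem hasSum_mul_relFreq {β : Type*} (M : Finset β) (v : β → ℕ) (f : ℕ → ℝ) :
    HasSum (fun k => ((M.filter fun T => v T = k).card : ℝ) / M.card * f k)
      ((∑ T ∈ M, f (v T)) / M.card) := by
  have h1 : ∀ T ∈ M, HasSum (fun k => if k = v T then f k else 0) (f (v T)) :=
    fun T _ => hasSum_ite_eq (v T) (f (v T)) |>.congr_fun fun k => by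
      by_cases h : k = v T <;> simp [h]
  have h2 := (hasSum_sum h1).div_const (M.card : ℝ)
  refine h2.congr_fun fun k => ?_
  rw [← Finset.sum_filter, Finset.filter_congr (q := fun T => v T = k) (fun T _ => eq_comm),
    Finset.sum_const, nsmul_eq_mul]
  ring

/-- The total variation distance as the largest difference of the means of a function bounded
by `1`. -/
theorem exists_dTV_eq_mean_sub {β : Type*} (M : Finset β) (v : β → ℕ) {z : ℝ}
    (hz : 0 ≤ z) : ∃ f : ℕ → ℝ, (∀ k, |f k| ≤ 1) ∧
      dTV (fun k => ((M.filter fun T => v T = k).card : ℝ) / M.card) (geomMass z) =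
        (∑ T ∈ M, f (v T)) / M.card - ∑' k, geomMass z k * f k := by
  set P : ℕ → ℝ := fun k => ((M.filter fun T => v T = k).card : ℝ) / M.card with hP
  refine ⟨fun k => if 0 ≤ P k - geomMass z k then 1 else -1, fun k => by dsimp only; split_ifs <;> simp, ?_⟩
  set f : ℕ → ℝ := fun k => if 0 ≤ P k - geomMass z k then 1 else -1 with hf
  have hf1 : ∀ k, |f k| ≤ 1 := fun k => by simp only [hf]; split_ifs <;> simp
  have h1 := (hasSum_mul_relFreq M v f).sub (summable_geomMass_mul hz hf1).hasSum
  rw [← h1.tsum_eq, dTV]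
  refine tsum_congr fun k => ?_
  simp only [hf]
  split_ifs with h
  · rw [abs_of_nonneg h]; simp only [hP]; ring
  · rw [abs_of_neg (not_le.mp h)]; simp only [hP]; ring

theorem dTV_relFreq_le_two {β : Type*} {M : Finset β} (hM : M.Nonempty) (v : β → ℕ) {z : ℝ}
    (hz : 0 ≤ z) :
    dTV (fun k => ((M.filter fun T => v T = k).card : ℝ) / M.card) (geomMass z) ≤ 2 := by
  obtain ⟨f, hf, h⟩ := exists_dTV_eq_mean_sub M v hz
  rw [h]
  have hMc : (0 : ℝ) < M.card := by exact_mod_cast hM.card_pos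
  have h1 : (∑ T ∈ M, f (v T)) / M.card ≤ 1 := by
    rw [div_le_one hMc]
    calc ∑ T ∈ M, f (v T) ≤ ∑ T ∈ M, (1 : ℝ) :=
          Finset.sum_le_sum fun T _ => (abs_le.mp (hf _)).2
      _ = _ := by simp
  have h2 := (abs_le.mp (abs_tsum_geomMass_mul_le hz hf)).1
  linarith

theorem dTV_relFreq_le {ι : Type*} [Fintype ι] [DecidableEq ι]
    {M : Finset (ι → ℕ)} (hM : M.Nonempty) {Z : ι → ℝ} (hZ : ∀ c, 0 ≤ Z c) {W : ℝ} (hW0 : 0 < W)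
    (hW : ∀ T ∈ M, ∏ c, geomMass (Z c) (T c) = W) (S : Finset ι) {z : ℝ} (hS : ∀ c ∈ S, Z c = z)
    {c₀ : ι} (hc₀ : c₀ ∈ S)
    (hexch : ∀ c ∈ S, ∀ k, (M.filter fun T => T c = k).card = (M.filter fun T => T c₀ = k).card)
    {s : ℝ} (hs : 0 < s) (hs' : s ≤ 1 / 2) :
    dTV (fun k => ((M.filter fun T => T c₀ = k).card : ℝ) / M.card) (geomMass z) ≤
      4 * s - Real.log (M.card * W) / (s * S.card) := by
  have hz : 0 ≤ z := hS c₀ hc₀ ▸ hZ c₀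
  obtain ⟨f, hf, h⟩ := exists_dTV_eq_mean_sub M (fun T => T c₀) hz
  rw [h]
  have hMc : (0 : ℝ) < M.card := by exact_mod_cast hM.card_pos
  have hSc : (0 : ℝ) < S.card := by exact_mod_cast Finset.card_pos.mpr ⟨c₀, hc₀⟩
  have hE : ∀ c ∈ S, ∑ T ∈ M, f (T c) = M.card * ((∑ T ∈ M, f (T c₀)) / M.card) := by
    intro c hc
    have h1 := hasSum_mul_relFreq M (fun T => T c) f
    simp only [hexch c hc] at h1
    rw [← h1.unique (hasSum_mul_relFreq M (fun T => T c₀) f)]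
    rw [mul_div_cancel₀ _ hMc.ne']
  have key := mean_sub_le_of_constant_weight hM hZ hW0 hW S hS hf hE hs.le hs'
  have h5 : 4 * s - Real.log (M.card * W) / (s * S.card) =
      (4 * s ^ 2 * S.card - Real.log (M.card * W)) / (s * S.card) := by
    rw [sub_div]
    congr 1
    rw [eq_div_iff (mul_pos hs hSc).ne']
    ring
  rw [h5, le_div_iff₀ (mul_pos hs hSc)]
  linarith

/-- The total variation distance of two geometric distributions. -/
theorem dTV_geomMass_le {z w : ℝ} (hz : 0 ≤ z) (hzw : z ≤ w) :
    Summable (fun k => |geomMass z k - geomMass w k|) ∧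
      ∑' k, |geomMass z k - geomMass w k| ≤ 2 * (w - z) / (1 + w) := by
  have hw : 0 ≤ w := hz.trans hzw
  have hqz : z / (1 + z) < 1 := by rw [div_lt_one (by positivity)]; linarith
  have hqw : w / (1 + w) < 1 := by rw [div_lt_one (by positivity)]; linarith
  have hqq : z / (1 + z) ≤ w / (1 + w) := by
    rw [div_le_div_iff₀ (by positivity) (by positivity)]; nlinarith
  have h1 := hasSum_geometric_of_lt_one (by positivity) hqz
  have h2 := hasSum_geometric_of_lt_one (by positivity) hqw
  have hi : 1 / (1 + w) ≤ 1 / (1 + z) := by gcongr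
  have hb : ∀ k, |geomMass z k - geomMass w k| ≤
      (1 / (1 + z) - 1 / (1 + w)) * (z / (1 + z)) ^ k +
        1 / (1 + w) * ((w / (1 + w)) ^ k - (z / (1 + z)) ^ k) := by
    intro k
    have e1 : geomMass z k - geomMass w k = (1 / (1 + z) - 1 / (1 + w)) * (z / (1 + z)) ^ k -
        1 / (1 + w) * ((w / (1 + w)) ^ k - (z / (1 + z)) ^ k) := by
      unfold geomMass; ring
    rw [e1]
    have p1 : 0 ≤ (1 / (1 + z) - 1 / (1 + w)) * (z / (1 + z)) ^ k :=
      mul_nonneg (by linarith) (by positivity)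
    have p2 : 0 ≤ 1 / (1 + w) * ((w / (1 + w)) ^ k - (z / (1 + z)) ^ k) := by
      refine mul_nonneg (by positivity) (sub_nonneg.mpr ?_)
      gcongr
    rw [abs_le]
    constructor <;> linarith
  have h3 := (h1.mul_left (1 / (1 + z) - 1 / (1 + w))).add ((h2.sub h1).mul_left (1 / (1 + w)))
  have hsm := Summable.of_nonneg_of_le (fun k => abs_nonneg _) hb h3.summable
  refine ⟨hsm, (hsm.tsum_le_tsum hb h3.summable).trans (le_of_eq ?_)⟩
  rw [h3.tsum_eq]
  have e1 : 1 - z / (1 + z) = 1 / (1 + z) := by field_simp; ring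
  have e2 : 1 - w / (1 + w) = 1 / (1 + w) := by field_simp; ring
  rw [e1, e2]
  field_simp
  ring

theorem dTV_geomMass_le_abs {z R : ℝ} (hz : 0 ≤ z) (hR : 0 ≤ R) :
    Summable (fun k => |geomMass z k - geomMass R k|) ∧
      ∑' k, |geomMass z k - geomMass R k| ≤ 2 * |z - R| / (1 + R) := by
  rcases le_total z R with h | h
  · have := dTV_geomMass_le hz h
    rwa [abs_sub_comm z R, abs_of_nonneg (by linarith : 0 ≤ R - z)]
  · have := dTV_geomMass_le hR h
    simp only [abs_sub_comm (geomMass R _)] at this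
    refine ⟨this.1, this.2.trans ?_⟩
    rw [abs_of_nonneg (by linarith : 0 ≤ z - R)]
    have : 0 ≤ z - R := by linarith
    gcongr

theorem dTV_relFreq_triangle {β : Type*} (M : Finset β) (v : β → ℕ) {z R : ℝ}
    (hz : 0 ≤ z) (hR : 0 ≤ R) :
    dTV (fun k => ((M.filter fun T => v T = k).card : ℝ) / M.card) (geomMass R) ≤
      dTV (fun k => ((M.filter fun T => v T = k).card : ℝ) / M.card) (geomMass z) +
        2 * |z - R| / (1 + R) := by
  have hP : Summable fun k => ((M.filter fun T => v T = k).card : ℝ) / M.card := by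
    simpa using (hasSum_mul_relFreq M v fun _ => 1).summable
  have h1 := (hP.sub (hasSum_geomMass hz).summable).abs
  have h2 := dTV_geomMass_le_abs hz hR
  have h3 := (hP.sub (hasSum_geomMass hR).summable).abs
  refine le_trans ?_ (add_le_add_right h2.2 _)
  unfold dTV
  rw [← h1.tsum_add h2.1]
  exact h3.tsum_le_tsum (fun k => abs_sub_le _ _ _) (h1.add h2.1)

/-- The contingency tables, as functions on the set of cells. -/
def cellTables {p q : ℕ} (r : Fin p → ℕ) (c : Fin q → ℕ) : Finset (Fin p × Fin q → ℕ) :=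
  ((tables_finite r c).preimage (f := Function.curry)
    (Function.curry_injective.injOn)).toFinset

theorem mem_cellTables {p q : ℕ} {r : Fin p → ℕ} {c : Fin q → ℕ} {T : Fin p × Fin q → ℕ} :
    T ∈ cellTables r c ↔ (∀ i, ∑ j, T (i, j) = r i) ∧ ∀ j, ∑ i, T (i, j) = c j := by
  simp [cellTables, tables, Function.curry]

theorem card_cellTables {p q : ℕ} (r : Fin p → ℕ) (c : Fin q → ℕ) :
    (cellTables r c).card = (tables r c).ncard := by
  rw [← Set.ncard_coe_finset]
  refine Set.ncard_congr (fun T _ => Function.curry T) ?_ ?_ ?_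
  · intro T hT
    simpa [cellTables] using hT
  · intro T T' _ _ h
    exact Function.curry_injective h
  · intro T hT
    exact ⟨Function.uncurry T, by simpa [cellTables] using hT, Function.curry_uncurry T⟩

theorem finite_functions_with_sum {α : Type*} [Fintype α] (a : ℕ) :
    {T : α → ℕ | ∑ x, T x = a}.Finite := by
  refine Set.Finite.subset (Set.Finite.pi' fun _ : α => Set.finite_Iic a) ?_
  intro T hT x
  have h := Finset.single_le_sum (f := T) (fun _ _ => Nat.zero_le _) (Finset.mem_univ x)
  exact h.trans (le_of_eq hT)

/-- The functions on the cells with prescribed block sums. -/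
def blockTables {ι κ : Type*} [Fintype ι] [DecidableEq κ] (lab : ι → κ) (a : κ → ℕ) :
    Set (ι → ℕ) :=
  {T | ∀ β, ∑ c with lab c = β, T c = a β}

theorem finite_blockTables {ι κ : Type*} [Fintype ι] [DecidableEq κ] (lab : ι → κ) (a : κ → ℕ) :
    (blockTables lab a).Finite := by
  refine Set.Finite.subset (Set.Finite.pi' fun c : ι => Set.finite_Iic (a (lab c))) ?_
  intro T hT x
  have h := Finset.single_le_sum (f := T) (s := Finset.univ.filter fun c => lab c = lab x)
    (a := x) (fun _ _ => Nat.zero_le _) (by simp)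
  exact h.trans (hT (lab x)).le

theorem prod_multichoose_le_ncard_blockTables {ι κ : Type*} [Fintype ι] [DecidableEq ι]
    [Fintype κ] [DecidableEq κ] (lab : ι → κ) (a : κ → ℕ) :
    ∏ β, (Finset.univ.filter fun c => lab c = β).card.multichoose (a β) ≤
      (blockTables lab a).ncard := by
  set F : ∀ β, Finset ({c // lab c = β} → ℕ) := fun β =>
    (finite_functions_with_sum (α := {c // lab c = β}) (a β)).toFinset with hF
  have hcard : ∀ β, (F β).card = (Finset.univ.filter fun c => lab c = β).card.multichoose (a β) := by
    intro β
    rw [← Fintype.card_subtype, ← card_functions_with_sum, ← Set.ncard_coe_finset]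
    simp [hF]
  rw [← Finset.prod_congr rfl fun β _ => hcard β, ← Fintype.card_piFinset,
    ← Set.ncard_coe_finset]
  refine Set.ncard_le_ncard_of_injOn (fun U c => U (lab c) ⟨c, rfl⟩) ?_ ?_
    (finite_blockTables lab a)
  · intro U hU β
    have hU' : U β ∈ F β := Fintype.mem_piFinset.mp hU β
    have h1 : ∑ x, U β x = a β := by simpa [hF] using hU'
    rw [← h1, Finset.sum_subtype (p := fun c => lab c = β) _ (by simp)]
    refine Finset.sum_congr rfl fun c _ => ?_
    obtain ⟨c, rfl⟩ := c
    rfl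
  · intro U _ U' _ h
    funext β ⟨c, hc⟩
    subst hc
    exact congrFun h c

section

variable {p : ℕ} {g : Fin p → Bool} {x : Bool → ℝ} {Z : Bool → Bool → ℝ}

theorem prod_pow_eq_prod_groups (g : Fin p → Bool) (x : Bool → ℝ) (t : Fin p → ℕ) :
    ∏ i, x (g i) ^ t i = ∏ b, x b ^ (∑ i with g i = b, t i) := by
  rw [← Finset.prod_fiberwise Finset.univ g]
  refine Finset.prod_congr rfl fun b _ => ?_
  rw [← Finset.prod_pow_eq_pow_sum]
  refine Finset.prod_congr rfl fun i hi => ?_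
  rw [(Finset.mem_filter.mp hi).2]

/-- If the geometric parameters factor, the weight of a table depends only on the total margins of
the groups. -/
theorem prod_geomMass_eq (hx : ∀ b b', Z b b' / (1 + Z b b') = x b * x b') (T : Fin p × Fin p → ℕ) :
    ∏ c : Fin p × Fin p, geomMass (Z (g c.1) (g c.2)) (T c) =
      (∏ c : Fin p × Fin p, 1 / (1 + Z (g c.1) (g c.2))) *
        ((∏ b, x b ^ (∑ i with g i = b, ∑ j, T (i, j))) *
          ∏ b, x b ^ (∑ j with g j = b, ∑ i, T (i, j))) := by
  simp only [geomMass, hx, mul_pow, Finset.prod_mul_distrib]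
  congr 2
  · rw [← prod_pow_eq_prod_groups, Fintype.prod_prod_type]
    simp only [Finset.prod_pow_eq_pow_sum]
  · rw [← prod_pow_eq_prod_groups, Fintype.prod_prod_type, Finset.prod_comm]
    simp only [Finset.prod_pow_eq_pow_sum]

theorem sum_group_rows (g : Fin p → Bool) (T : Fin p × Fin p → ℕ) (b : Bool) :
    ∑ i with g i = b, ∑ j, T (i, j) =
      ∑ b', ∑ c with (g c.1, g c.2) = (b, b'), T c := by
  have : ∀ b', (Finset.univ.filter fun c : Fin p × Fin p => (g c.1, g c.2) = (b, b')) =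
      (Finset.univ.filter fun i => g i = b) ×ˢ (Finset.univ.filter fun j => g j = b') := by
    intro b'; ext c; simp
  simp only [this, Finset.sum_product]
  conv_rhs => rw [Finset.sum_comm]
  exact Finset.sum_congr rfl fun i _ =>
    (Finset.sum_fiberwise Finset.univ g fun j => T (i, j)).symm

theorem sum_group_columns (g : Fin p → Bool) (T : Fin p × Fin p → ℕ) (b' : Bool) :
    ∑ j with g j = b', ∑ i, T (i, j) =
      ∑ b, ∑ c with (g c.1, g c.2) = (b, b'), T c := by
  have : ∀ b, (Finset.univ.filter fun c : Fin p × Fin p => (g c.1, g c.2) = (b, b')) =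
      (Finset.univ.filter fun i => g i = b) ×ˢ (Finset.univ.filter fun j => g j = b') := by
    intro b; ext c; simp
  simp only [this, Finset.sum_product_right]
  conv_rhs => rw [Finset.sum_comm]
  exact Finset.sum_congr rfl fun j _ =>
    (Finset.sum_fiberwise Finset.univ g fun i => T (i, j)).symm

theorem sum_group_const (g : Fin p → Bool) (ρ : Bool → ℕ) (b : Bool) :
    ∑ i with g i = b, ρ (g i) = (Finset.univ.filter fun i => g i = b).card * ρ b := by
  rw [Finset.sum_congr rfl (g := fun _ => ρ b)
    fun i hi => by rw [(Finset.mem_filter.mp hi).2]]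
  simp

theorem prod_geomMass_blockTables {a : Bool × Bool → ℕ} {T : Fin p × Fin p → ℕ}
    (hT : T ∈ blockTables (fun c => (g c.1, g c.2)) a) :
    ∏ c : Fin p × Fin p, geomMass (Z (g c.1) (g c.2)) (T c) =
      ∏ β : Bool × Bool, ((1 / (1 + Z β.1 β.2)) ^
        (Finset.univ.filter fun c : Fin p × Fin p => (g c.1, g c.2) = β).card *
          (Z β.1 β.2 / (1 + Z β.1 β.2)) ^ a β) := by
  rw [← Finset.prod_fiberwise Finset.univ (fun c : Fin p × Fin p => (g c.1, g c.2))]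
  refine Finset.prod_congr rfl fun β _ => ?_
  rw [← hT β, ← Finset.prod_pow_eq_pow_sum, ← Finset.prod_const, ← Finset.prod_mul_distrib]
  refine Finset.prod_congr rfl fun c hc => ?_
  rw [← (Finset.mem_filter.mp hc).2]
  rfl

/-- There are not many more tables with prescribed block sums than tables with prescribed
margins, provided that the margins are constant on the groups. -/
theorem ncard_blockTables_le {ρ : Bool → ℕ} {a : Bool × Bool → ℕ}
    (ha : ∀ b, ∑ b', a (b, b') = (Finset.univ.filter fun i => g i = b).card * ρ b)
    (ha' : ∀ b', ∑ b, a (b, b') = (Finset.univ.filter fun i => g i = b').card * ρ b') :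
    (blockTables (fun c : Fin p × Fin p => (g c.1, g c.2)) a).ncard ≤
      (cellTables (fun i => ρ (g i)) fun i => ρ (g i)).card *
        (∑ β, a β + 1) ^ (2 * p) := by
  set G := (finite_blockTables (fun c : Fin p × Fin p => (g c.1, g c.2)) a).toFinset with hG
  have hGc : (blockTables (fun c : Fin p × Fin p => (g c.1, g c.2)) a).ncard = G.card := by
    rw [← Set.ncard_coe_finset]; simp [hG]
  have hmem : ∀ T, T ∈ G ↔ T ∈ blockTables (fun c : Fin p × Fin p => (g c.1, g c.2)) a := by
    simp [hG]
  rw [hGc]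
  set B : Finset (Fin p → ℕ) := Fintype.piFinset fun _ => Finset.range (∑ β, a β + 1) with hB
  have hcard : (B ×ˢ B).card = (∑ β, a β + 1) ^ (2 * p) := by
    rw [Finset.card_product, hB, Fintype.card_piFinset]
    simp [two_mul, pow_add]
  rw [← hcard]
  have htot : ∀ T ∈ G, ∑ c, T c = ∑ β, a β := by
    intro T hT
    rw [← Finset.sum_fiberwise Finset.univ (fun c : Fin p × Fin p => (g c.1, g c.2))]
    exact Finset.sum_congr rfl fun β _ => (hmem T).mp hT β
  refine Finset.card_le_mul_card_image_of_maps_to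
    (f := fun T : Fin p × Fin p → ℕ => (fun i => ∑ j, T (i, j), fun j => ∑ i, T (i, j))) ?_ _ ?_
  · intro T hT
    simp only [Finset.mem_product, hB, Fintype.mem_piFinset, Finset.mem_range, Nat.lt_succ_iff]
    rw [← htot T hT]
    constructor
    · intro i
      rw [Fintype.sum_prod_type]
      exact Finset.single_le_sum (f := fun i => ∑ j, T (i, j)) (fun _ _ => Nat.zero_le _)
        (Finset.mem_univ i)
    · intro j
      rw [Fintype.sum_prod_type_right]
      exact Finset.single_le_sum (f := fun j => ∑ i, T (i, j)) (fun _ _ => Nat.zero_le _)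
        (Finset.mem_univ j)
  · rintro ⟨r', c'⟩ _
    rcases Finset.eq_empty_or_nonempty (G.filter fun T : Fin p × Fin p → ℕ =>
      ((fun i => ∑ j, T (i, j), fun j => ∑ i, T (i, j)) : (Fin p → ℕ) × (Fin p → ℕ)) = (r', c'))
      with h | ⟨T, hT⟩
    · rw [h]; simp
    · rw [Finset.mem_filter, Prod.mk.injEq] at hT
      obtain ⟨hTG, hr, hc⟩ := hT
      have hTG' := (hmem T).mp hTG
      calc _ ≤ (cellTables r' c').card := by
            refine Finset.card_le_card fun T' hT' => ?_
            rw [Finset.mem_filter, Prod.mk.injEq] at hT'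
            rw [mem_cellTables]
            exact ⟨congrFun hT'.2.1, congrFun hT'.2.2⟩
        _ ≤ _ := by
            rw [card_cellTables, card_cellTables]
            refine ncard_tables_le_of_groups g ρ r' c' (fun b => ?_) fun b => ?_
            · rw [sum_group_const, ← ha, ← hr, sum_group_rows]
              exact Finset.sum_congr rfl fun b' _ => hTG' (b, b')
            · rw [sum_group_const, ← ha', ← hc, sum_group_columns]
              exact Finset.sum_congr rfl fun b' _ => hTG' (b', b)

theorem card_block (g : Fin p → Bool) (β : Bool × Bool) :
    (Finset.univ.filter fun c : Fin p × Fin p => (g c.1, g c.2) = β).card =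
      (Finset.univ.filter fun i => g i = β.1).card *
        (Finset.univ.filter fun i => g i = β.2).card := by
  rw [← Finset.card_product]
  congr 1
  ext c
  simp [Prod.ext_iff]

/-- The probability that a random table with independent geometric entries, of means adapted to
the margins, has the right margins is not too small. -/
theorem exists_weight {ρ : Bool → ℕ} {a : Bool × Bool → ℕ}
    (hZ : ∀ b b', 0 < Z b b') (hxpos : ∀ b, 0 < x b)
    (hx : ∀ b b', Z b b' / (1 + Z b b') = x b * x b')
    (hg : ∀ b, 1 ≤ (Finset.univ.filter fun i => g i = b).card)
    (ha : ∀ b, ∑ b', a (b, b') = (Finset.univ.filter fun i => g i = b).card * ρ b)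
    (ha' : ∀ b', ∑ b, a (b, b') = (Finset.univ.filter fun i => g i = b').card * ρ b')
    (hnear : ∀ β : Bool × Bool, |(a β : ℝ) - ((Finset.univ.filter fun i => g i = β.1).card *
      (Finset.univ.filter fun i => g i = β.2).card : ℕ) * Z β.1 β.2| ≤ 1) :
    ∃ W : ℝ, 0 < W ∧
      (∀ T ∈ cellTables (fun i => ρ (g i)) fun i => ρ (g i),
        ∏ c : Fin p × Fin p, geomMass (Z (g c.1) (g c.2)) (T c) = W) ∧
      ∏ β : Bool × Bool, (Real.exp (-(4 + 1 / (((Finset.univ.filter fun i => g i = β.1).card *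
          (Finset.univ.filter fun i => g i = β.2).card : ℕ) * Z β.1 β.2))) /
        (2 * (((Finset.univ.filter fun i => g i = β.1).card *
          (Finset.univ.filter fun i => g i = β.2).card : ℕ) + a β) * (a β + 1))) ≤
        (cellTables (fun i => ρ (g i)) fun i => ρ (g i)).card * W *
          ((∑ β, a β + 1 : ℕ) : ℝ) ^ (2 * p) := by
  set κ : Bool → ℕ := fun b => (Finset.univ.filter fun i => g i = b).card with hκ
  set W := (∏ c : Fin p × Fin p, 1 / (1 + Z (g c.1) (g c.2))) *
        ((∏ b, x b ^ (κ b * ρ b)) * ∏ b, x b ^ (κ b * ρ b)) with hW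
  have hWpos : 0 < W := by
    refine mul_pos (Finset.prod_pos fun c _ => ?_) (mul_pos ?_ ?_)
    · have := hZ (g c.1) (g c.2)
      positivity
    · exact Finset.prod_pos fun b _ => pow_pos (hxpos b) _
    · exact Finset.prod_pos fun b _ => pow_pos (hxpos b) _
  refine ⟨W, hWpos, fun T hT => ?_, ?_⟩
  · rw [mem_cellTables] at hT
    rw [prod_geomMass_eq hx, hW]
    simp only [hT.1, hT.2, sum_group_const]
    rfl
  · have hWG : (∏ β : Bool × Bool, ((1 / (1 + Z β.1 β.2)) ^ (κ β.1 * κ β.2) *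
        (Z β.1 β.2 / (1 + Z β.1 β.2)) ^ a β)) *
          (blockTables (fun c : Fin p × Fin p => (g c.1, g c.2)) a).ncard ≤
        W * (blockTables (fun c : Fin p × Fin p => (g c.1, g c.2)) a).ncard := by
      rcases Set.eq_empty_or_nonempty
        (blockTables (fun c : Fin p × Fin p => (g c.1, g c.2)) a) with h | ⟨T, hT⟩
      · simp [h]
      · refine le_of_eq ?_
        congr 1
        have h1 := prod_geomMass_blockTables (Z := Z) hT
        rw [prod_geomMass_eq hx] at h1
        simp only [card_block] at h1
        refine h1.symm.trans ?_
        have hT' : ∀ b b', ∑ c with (g c.1, g c.2) = (b, b'), T c = a (b, b') :=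
          fun b b' => hT (b, b')
        rw [hW]
        simp only [sum_group_rows, sum_group_columns, hT', ha, ha']
        rfl
    have h2 : ((∏ β : Bool × Bool, (κ β.1 * κ β.2).multichoose (a β) : ℕ) : ℝ) ≤
        (blockTables (fun c : Fin p × Fin p => (g c.1, g c.2)) a).ncard := by
      have := prod_multichoose_le_ncard_blockTables (fun c : Fin p × Fin p => (g c.1, g c.2)) a
      simp only [card_block] at this
      exact_mod_cast this
    have h3 : ((blockTables (fun c : Fin p × Fin p => (g c.1, g c.2)) a).ncard : ℝ) ≤
        (cellTables (fun i => ρ (g i)) fun i => ρ (g i)).card *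
          ((∑ β, a β + 1 : ℕ) : ℝ) ^ (2 * p) := by
      exact_mod_cast ncard_blockTables_le ha ha'
    have hq : 0 ≤ ∏ β : Bool × Bool, ((1 / (1 + Z β.1 β.2)) ^ (κ β.1 * κ β.2) *
        (Z β.1 β.2 / (1 + Z β.1 β.2)) ^ a β) := by
      refine Finset.prod_nonneg fun β _ => ?_
      have := hZ β.1 β.2
      positivity
    calc _ ≤ ∏ β : Bool × Bool, (((κ β.1 * κ β.2).multichoose (a β) : ℝ) *
          ((1 / (1 + Z β.1 β.2)) ^ (κ β.1 * κ β.2) *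
            (Z β.1 β.2 / (1 + Z β.1 β.2)) ^ a β)) := by
          refine Finset.prod_le_prod (fun β _ => ?_) fun β _ => ?_
          · positivity
          · exact negBinomial_lower_bound (Nat.mul_pos (hg _) (hg _)) _ (hZ _ _) (hnear β)
      _ = (∏ β : Bool × Bool, ((1 / (1 + Z β.1 β.2)) ^ (κ β.1 * κ β.2) *
            (Z β.1 β.2 / (1 + Z β.1 β.2)) ^ a β)) *
            ((∏ β : Bool × Bool, (κ β.1 * κ β.2).multichoose (a β) : ℕ) : ℝ) := by
          rw [Finset.prod_mul_distrib]
          push_cast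
          ring
      _ ≤ _ := mul_le_mul_of_nonneg_left h2 hq
      _ ≤ _ := hWG
      _ ≤ _ := mul_le_mul_of_nonneg_left h3 hWpos.le
      _ = _ := by ring

end

/-- Exchangeability of the entries within a block. -/
theorem card_filter_cellTables_eq {p : ℕ} {r : Fin p → ℕ} {i j i' j' : Fin p} (hi : r i = r i')
    (hj : r j = r j') (k : ℕ) :
    ((cellTables r r).filter fun T => T (i, j) = k).card =
      ((cellTables r r).filter fun T => T (i', j') = k).card := by
  have hsw : ∀ {u v : Fin p}, r u = r v → ∀ l, r (Equiv.swap u v l) = r l := by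
    intro u v h l
    rcases eq_or_ne l u with rfl | h1
    · rw [Equiv.swap_apply_left, h]
    · rcases eq_or_ne l v with rfl | h2
      · rw [Equiv.swap_apply_right, h]
      · rw [Equiv.swap_apply_of_ne_of_ne h1 h2]
  have hmem : ∀ T ∈ cellTables r r,
      (fun c : Fin p × Fin p => T (Equiv.swap i i' c.1, Equiv.swap j j' c.2)) ∈
        cellTables r r := by
    intro T hT
    rw [mem_cellTables] at hT ⊢
    constructor
    · intro l
      rw [Equiv.sum_comp (Equiv.swap j j') fun m => T (Equiv.swap i i' l, m), hT.1, hsw hi]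
    · intro l
      rw [Equiv.sum_comp (Equiv.swap i i') fun m => T (m, Equiv.swap j j' l), hT.2, hsw hj]
  refine Finset.card_bij' (fun T _ => fun c => T (Equiv.swap i i' c.1, Equiv.swap j j' c.2))
    (fun T _ => fun c => T (Equiv.swap i i' c.1, Equiv.swap j j' c.2)) ?_ ?_ ?_ ?_
  · intro T hT
    rw [Finset.mem_filter] at hT ⊢
    exact ⟨hmem T hT.1, by simpa using hT.2⟩
  · intro T hT
    rw [Finset.mem_filter] at hT ⊢
    exact ⟨hmem T hT.1, by simpa using hT.2⟩
  · intro T _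
    funext c
    simp
  · intro T _
    funext c
    simp

theorem uniformTable_real_eq {p : ℕ} (r : Fin p → ℕ) (i j : Fin p) (k : ℕ) :
    (uniformTable r r).real {X | X i j = k} =
      (((cellTables r r).filter fun T => T (i, j) = k).card : ℝ) / (cellTables r r).card := by
  have h1 : (uniformTable r r) {X | X i j = k} =
      (Measure.count (tables r r))⁻¹ * Measure.count (tables r r ∩ {X | X i j = k}) :=
    cond_apply (tables_finite r r).measurableSet _ _
  have h2 : (tables r r ∩ {X | X i j = k}).ncard =
      ((cellTables r r).filter fun T => T (i, j) = k).card := by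
    rw [← Set.ncard_coe_finset]
    refine Set.ncard_congr (fun T _ => Function.uncurry T) ?_ ?_ ?_
    · intro T hT
      simpa [mem_cellTables, tables] using hT
    · intro T T' _ _ h
      exact Function.uncurry_injective h
    · intro T hT
      exact ⟨Function.curry T, by simpa [mem_cellTables, tables] using hT, Function.uncurry_curry T⟩
  have hc : ∀ s : Set (Fin p → Fin p → ℕ), s.Finite → (Measure.count s).toReal = s.ncard := by
    intro s hs
    rw [Measure.count_apply hs.measurableSet, ← hs.cast_ncard_eq]
    simp
  rw [Measure.real, h1, ENNReal.toReal_mul, ENNReal.toReal_inv, hc _ (tables_finite r r),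
    hc _ ((tables_finite r r).inter_of_left _), h2, card_cellTables]
  ring

/-- The success parameter of the geometric distribution with mean `z`. -/
def geomRatio (z : ℝ) : ℝ := z / (1 + z)

theorem geomRatio_nonneg {z : ℝ} (hz : 0 ≤ z) : 0 ≤ geomRatio z := by
  unfold geomRatio; positivity

theorem geomRatio_pos {z : ℝ} (hz : 0 < z) : 0 < geomRatio z := by
  unfold geomRatio; positivity

theorem geomRatio_lt_one {z : ℝ} (hz : 0 ≤ z) : geomRatio z < 1 := by
  unfold geomRatio
  rw [div_lt_one (by positivity)]; linarith

theorem geomRatio_le_self {z : ℝ} (hz : 0 ≤ z) : geomRatio z ≤ z := by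
  unfold geomRatio
  exact div_le_self hz (by linarith)

theorem geomRatio_mono {z w : ℝ} (hz : 0 ≤ z) (hzw : z ≤ w) : geomRatio z ≤ geomRatio w := by
  unfold geomRatio
  rw [div_le_div_iff₀ (by linarith) (by linarith)]; nlinarith

theorem one_sub_geomRatio {z : ℝ} (hz : 0 ≤ z) : 1 - geomRatio z = 1 / (1 + z) := by
  unfold geomRatio; field_simp; ring

/-- The means `u`, `v`, `w` of the entries of the typical table in the top left block, the side
blocks and the bottom right block. -/
structure IsTypical (m n r₁ r₂ u v w : ℝ) : Prop where
  u_pos : 0 < u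
  v_pos : 0 < v
  w_pos : 0 < w
  top : m * u + n * v = r₁
  bottom : m * v + n * w = r₂
  balance : geomRatio u * geomRatio w = geomRatio v ^ 2

theorem exists_isTypical {m n r₁ r₂ μ : ℝ} (hm : 0 < m) (hmn : m ≤ n) (hμ : 0 < μ)
    (h₁ : 2 * μ * n ≤ r₁) (h₂ : 2 * μ * n ≤ r₂) :
    ∃ u v w, IsTypical m n r₁ r₂ u v w ∧ geomRatio μ ^ 2 ≤ u ∧ geomRatio μ ^ 2 ≤ v ∧
      geomRatio μ ^ 2 ≤ w := by
  have hn : 0 < n := hm.trans_le hmn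
  have hr₁ : 0 < r₁ := lt_of_lt_of_le (by positivity) h₁
  have hr₂ : 0 < r₂ := lt_of_lt_of_le (by positivity) h₂
  set t := min (r₁ / n) (r₂ / m) with ht
  have ht0 : 0 < t := lt_min (by positivity) (by positivity)
  have hu : ∀ v ∈ Set.Icc 0 t, 0 ≤ (r₁ - n * v) / m := by
    intro v hv
    have : v ≤ r₁ / n := hv.2.trans (min_le_left _ _)
    rw [le_div_iff₀ hn] at this
    exact div_nonneg (by linarith) hm.le
  have hw : ∀ v ∈ Set.Icc 0 t, 0 ≤ (r₂ - m * v) / n := by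
    intro v hv
    have : v ≤ r₂ / m := hv.2.trans (min_le_right _ _)
    rw [le_div_iff₀ hm] at this
    exact div_nonneg (by linarith) hn.le
  set h : ℝ → ℝ := fun v => geomRatio ((r₁ - n * v) / m) * geomRatio ((r₂ - m * v) / n) -
    geomRatio v ^ 2 with hh
  have hcont : ContinuousOn h (Set.Icc 0 t) := by
    have c1 : ContinuousOn (fun v => geomRatio ((r₁ - n * v) / m)) (Set.Icc 0 t) := by
      unfold geomRatio
      refine ContinuousOn.div (by fun_prop) (by fun_prop) fun v hv => ?_
      have := hu v hv
      positivity
    have c2 : ContinuousOn (fun v => geomRatio ((r₂ - m * v) / n)) (Set.Icc 0 t) := by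
      unfold geomRatio
      refine ContinuousOn.div (by fun_prop) (by fun_prop) fun v hv => ?_
      have := hw v hv
      positivity
    have c3 : ContinuousOn geomRatio (Set.Icc 0 t) := by
      unfold geomRatio
      refine ContinuousOn.div (by fun_prop) (by fun_prop) fun v hv => ?_
      have := hv.1
      positivity
    exact (c1.mul c2).sub (c3.pow 2)
  have h0 : 0 ≤ h 0 := by
    have e1 := geomRatio_nonneg (hu 0 ⟨le_rfl, ht0.le⟩)
    have e2 := geomRatio_nonneg (hw 0 ⟨le_rfl, ht0.le⟩)
    have : geomRatio 0 = 0 := by simp [geomRatio]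
    simp only [hh, this]
    nlinarith [mul_nonneg e1 e2]
  have h1 : h t ≤ 0 := by
    have : geomRatio ((r₁ - n * t) / m) * geomRatio ((r₂ - m * t) / n) = 0 := by
      rcases min_choice (r₁ / n) (r₂ / m) with h | h
      · have : r₁ - n * t = 0 := by rw [ht, h]; field_simp; ring
        rw [this]; simp [geomRatio]
      · have : r₂ - m * t = 0 := by rw [ht, h]; field_simp; ring
        rw [this]; simp [geomRatio]
    simp only [hh, this]
    nlinarith [sq_nonneg (geomRatio t)]
  obtain ⟨v, hv, hv0⟩ := intermediate_value_Icc' ht0.le hcont ⟨h1, h0⟩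
  set u := (r₁ - n * v) / m with hu'
  set w := (r₂ - m * v) / n with hw'
  have hu0 := hu v hv
  have hw0 := hw v hv
  rw [← hu'] at hu0
  rw [← hw'] at hw0
  have hbal : geomRatio u * geomRatio w = geomRatio v ^ 2 := by
    simp only [hh] at hv0; linarith
  have htop : m * u + n * v = r₁ := by rw [hu']; field_simp; ring
  have hbot : m * v + n * w = r₂ := by rw [hw']; field_simp; ring
  have hμv : μ ≤ v := by
    by_contra! hlt
    have e1 : μ ≤ u := by
      have : m * μ ≤ m * u := by nlinarith
      exact le_of_mul_le_mul_left this hm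
    have e2 : μ ≤ w := by
      have : n * μ ≤ n * w := by nlinarith [hv.1]
      exact le_of_mul_le_mul_left this hn
    have e3 : geomRatio μ * geomRatio μ ≤ geomRatio v ^ 2 := by
      rw [← hbal]
      exact mul_le_mul (geomRatio_mono hμ.le e1) (geomRatio_mono hμ.le e2)
        (geomRatio_nonneg hμ.le) (geomRatio_nonneg hu0)
    have e4 : geomRatio v < geomRatio μ := by
      unfold geomRatio
      have := hv.1
      rw [div_lt_div_iff₀ (by linarith) (by linarith)]; nlinarith
    nlinarith [geomRatio_nonneg hv.1]
  have hqμ := geomRatio_pos hμ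
  have hqv : geomRatio μ ≤ geomRatio v := geomRatio_mono hμ.le hμv
  have hqu := geomRatio_nonneg hu0
  have hqw := geomRatio_nonneg hw0
  have hqu1 := geomRatio_lt_one hu0
  have hqw1 := geomRatio_lt_one hw0
  have hsq : geomRatio μ ^ 2 ≤ geomRatio u * geomRatio w := by
    rw [hbal]; gcongr
  have hu1 : geomRatio μ ^ 2 ≤ u := by
    refine le_trans ?_ (geomRatio_le_self hu0)
    nlinarith
  have hw1 : geomRatio μ ^ 2 ≤ w := by
    refine le_trans ?_ (geomRatio_le_self hw0)
    nlinarith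
  have hv1 : geomRatio μ ^ 2 ≤ v := by
    have := geomRatio_le_self hμ.le
    have := geomRatio_lt_one hμ.le
    nlinarith
  have hpos : 0 < geomRatio μ ^ 2 := by positivity
  exact ⟨u, v, w, ⟨by linarith, by linarith, by linarith, htop, hbot, hbal⟩, hu1, hv1, hw1⟩

/-- The symmetric matrix indexed by `Bool` with entries `u`, `v`, `w`, where `true` is the label of
the top rows. -/
def blockFun {α : Type*} (u v w : α) (b b' : Bool) : α :=
  bif b then bif b' then u else v else bif b' then v else w

/-- Integers near the block sums of the typical table which are compatible with the margins. -/
theorem exists_blockSums {m n r₁ r₂ : ℕ} {u v w : ℝ} (h : IsTypical m n r₁ r₂ u v w) (hn : 1 ≤ n) :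
    ∃ a b d : ℕ, a + b = m * r₁ ∧ b + d = n * r₂ ∧ |(a : ℝ) - m * m * u| ≤ 1 ∧
      |(b : ℝ) - m * n * v| ≤ 1 ∧ |(d : ℝ) - n * n * w| ≤ 1 := by
  have hn' : (0 : ℝ) < n := by exact_mod_cast hn
  have hu := h.u_pos
  have hv := h.v_pos
  have hw := h.w_pos
  have e1 : (m : ℝ) * m * u + m * n * v = m * r₁ := by rw [← h.top]; ring
  have e2 : (m : ℝ) * n * v + n * n * w = n * r₂ := by rw [← h.bottom]; ring
  have f1 := Nat.floor_le (by positivity : (0 : ℝ) ≤ m * m * u)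
  have f2 := Nat.lt_floor_add_one ((m : ℝ) * m * u)
  set a := ⌊(m : ℝ) * m * u⌋₊ with ha
  have hmv : 0 ≤ (m : ℝ) * n * v := by positivity
  have hnw : 0 < (n : ℝ) * n * w := by positivity
  have ha1 : a ≤ m * r₁ := by
    have : (a : ℝ) ≤ m * r₁ := by linarith
    exact_mod_cast this
  obtain ⟨b, hb⟩ := Nat.exists_eq_add_of_le ha1
  have hb' : (a : ℝ) + b = m * r₁ := by exact_mod_cast hb.symm
  have hb1 : b ≤ n * r₂ := by
    have : (b : ℝ) < n * r₂ + 1 := by linarith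
    have : b < n * r₂ + 1 := by exact_mod_cast this
    omega
  obtain ⟨d, hd⟩ := Nat.exists_eq_add_of_le hb1
  have hd' : (b : ℝ) + d = n * r₂ := by exact_mod_cast hd.symm
  refine ⟨a, b, d, hb.symm, hd.symm, ?_, ?_, ?_⟩ <;> rw [abs_le] <;> constructor <;> linarith

theorem blockFactor_lower_bound {n k k' e : ℕ} {A ν z : ℝ} (hAn : (n : ℝ) ^ 2 ≤ A * n ^ 2)
    (hn2 : (1 : ℝ) ≤ (n : ℝ) ^ 2) (hν : 0 < ν)
    (hk : 1 ≤ k) (hk' : 1 ≤ k') (hkn : k ≤ n) (hkn' : k' ≤ n) (he : (e : ℝ) ≤ A * n ^ 2)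
    (hz : ν ≤ z) :
    Real.exp (-(4 + 1 / ν)) / (5 * A * (n : ℝ) ^ 2) ^ 2 ≤
      Real.exp (-(4 + 1 / ((k * k' : ℕ) * z))) / (2 * ((k * k' : ℕ) + e) * (e + 1)) := by
  have hz0 : 0 < z := hν.trans_le hz
  have hkk : (1 : ℝ) ≤ (k * k' : ℕ) := by exact_mod_cast Nat.mul_pos hk hk'
  have hkk' : ((k * k' : ℕ) : ℝ) ≤ n ^ 2 := by
    rw [pow_two]; exact_mod_cast Nat.mul_le_mul hkn hkn'
  have e1 : 2 * (((k * k' : ℕ) : ℝ) + e) * (e + 1) ≤ (5 * A * (n : ℝ) ^ 2) ^ 2 := by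
    have : ((k * k' : ℕ) : ℝ) + e ≤ 2 * (A * n ^ 2) := by linarith
    have : (e : ℝ) + 1 ≤ 2 * (A * n ^ 2) := by linarith
    calc 2 * (((k * k' : ℕ) : ℝ) + e) * (e + 1)
        ≤ 2 * (2 * (A * n ^ 2)) * (2 * (A * n ^ 2)) := by
          have : (0 : ℝ) ≤ 2 * (2 * (A * n ^ 2)) := by linarith
          gcongr
      _ ≤ (5 * A * (n : ℝ) ^ 2) ^ 2 := by nlinarith [sq_nonneg (A * (n : ℝ) ^ 2)]
  have e2 : 1 / (((k * k' : ℕ) : ℝ) * z) ≤ 1 / ν := by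
    apply one_div_le_one_div_of_le hν
    nlinarith
  have e3 : 0 < 2 * (((k * k' : ℕ) : ℝ) + e) * (e + 1) := by positivity
  gcongr

theorem neg_log_le_of_pow_le {m n : ℕ} {X Q ν : ℝ} (hn : 1 ≤ n) (hmn : m ≤ n) (hQ1 : 1 ≤ Q)
    (hX : (Real.exp (-(4 + 1 / ν)) / Q ^ 2) ^ 4 ≤ X * Q ^ (2 * (m + n))) :
    -Real.log X ≤ 16 + 4 / ν + 12 * n * Real.log Q := by
  have hn' : (1 : ℝ) ≤ n := by exact_mod_cast hn
  have hmn' : (m : ℝ) ≤ n := by exact_mod_cast hmn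
  have hQ0 : 0 < Q := by linarith
  have h2 : 0 < (Real.exp (-(4 + 1 / ν)) / Q ^ 2) ^ 4 := by positivity
  have hX0 : 0 < X := pos_of_mul_pos_left (h2.trans_le hX) (by positivity)
  have hlog := Real.log_le_log h2 hX
  rw [Real.log_pow, Real.log_div (Real.exp_pos _).ne' (by positivity), Real.log_exp, Real.log_pow,
    Real.log_mul (by positivity) (by positivity), Real.log_pow] at hlog
  push_cast at hlog
  have hlQ : 0 ≤ Real.log Q := Real.log_nonneg hQ1
  have e4 : 4 / ν = 4 * (1 / ν) := by ring
  rw [e4]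
  have e5 : (m : ℝ) * Real.log Q ≤ n * Real.log Q := by gcongr
  have e6 : Real.log Q ≤ n * Real.log Q := by nlinarith
  linarith

theorem exists_weight_two_groups {p m n r₁ r₂ : ℕ} {g : Fin p → Bool} {u v w A ν : ℝ}
    (hm : 1 ≤ m) (hmn : m ≤ n) (hp : p = m + n)
    (hgt : (Finset.univ.filter fun i => g i = true).card = m)
    (hgf : (Finset.univ.filter fun i => g i = false).card = n)
    (h : IsTypical m n r₁ r₂ u v w) (hA : 1 ≤ A) (hr₁ : r₁ ≤ A * n) (hr₂ : r₂ ≤ A * n)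
    (hν : 0 < ν) (hu : ν ≤ u) (hv : ν ≤ v) (hw : ν ≤ w) :
    ∃ W : ℝ, 0 < W ∧
      (∀ T ∈ cellTables (fun i => bif g i then r₁ else r₂) fun i => bif g i then r₁ else r₂,
        ∏ c : Fin p × Fin p, geomMass (blockFun u v w (g c.1) (g c.2)) (T c) = W) ∧
      -Real.log ((cellTables (fun i => bif g i then r₁ else r₂)
          fun i => bif g i then r₁ else r₂).card * W) ≤
        16 + 4 / ν + 12 * n * Real.log (5 * A * n ^ 2) := by
  have hn : 1 ≤ n := hm.trans hmn
  have hm' : (1 : ℝ) ≤ m := by exact_mod_cast hm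
  have hn' : (1 : ℝ) ≤ n := by exact_mod_cast hn
  have hmn' : (m : ℝ) ≤ n := by exact_mod_cast hmn
  obtain ⟨a, b, d, hab, hbd, hna, hnb, hnd⟩ := exists_blockSums h hn
  set Q := 5 * A * (n : ℝ) ^ 2 with hQ
  have hn2 : (1 : ℝ) ≤ (n : ℝ) ^ 2 := one_le_pow₀ hn'
  have hAn : (n : ℝ) ^ 2 ≤ A * n ^ 2 := by nlinarith
  have hQ1 : 1 ≤ Q := by nlinarith
  have hma : (a : ℝ) + b ≤ A * n ^ 2 := by
    have : (a : ℝ) + b = m * r₁ := by exact_mod_cast hab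
    rw [this]
    calc (m : ℝ) * r₁ ≤ n * (A * n) := by gcongr
      _ = _ := by ring
  have hmb : (b : ℝ) + d ≤ A * n ^ 2 := by
    have : (b : ℝ) + d = n * r₂ := by exact_mod_cast hbd
    rw [this]
    calc (n : ℝ) * r₂ ≤ n * (A * n) := by gcongr
      _ = _ := by ring
  have ha0 : (0 : ℝ) ≤ a := by positivity
  have hb0 : (0 : ℝ) ≤ b := by positivity
  have hd0 : (0 : ℝ) ≤ d := by positivity
  have hAa : (a : ℝ) ≤ A * n ^ 2 := by linarith
  have hAb : (b : ℝ) ≤ A * n ^ 2 := by linarith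
  have hAd : (d : ℝ) ≤ A * n ^ 2 := by linarith
  have hs : ((a + b + (b + d) + 1 : ℕ) : ℝ) ≤ Q := by
    push_cast
    linarith
  have hqu := geomRatio_pos h.u_pos
  have hqw := geomRatio_pos h.w_pos
  have hqv := geomRatio_pos h.v_pos
  have hsqrt : √(geomRatio u) * √(geomRatio w) = geomRatio v := by
    rw [← Real.sqrt_mul hqu.le, h.balance, Real.sqrt_sq hqv.le]
  obtain ⟨W, hW0, hW, hbound⟩ := exists_weight (g := g) (x := fun b => bif b then √(geomRatio u)
      else √(geomRatio w)) (Z := blockFun u v w) (ρ := fun b => bif b then r₁ else r₂)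
      (a := fun β => blockFun a b d β.1 β.2)
      (by rintro (_ | _) (_ | _); exacts [h.w_pos, h.v_pos, h.v_pos, h.u_pos])
      (by
        rintro (_ | _)
        exacts [Real.sqrt_pos.mpr hqw, Real.sqrt_pos.mpr hqu])
      (by
        rintro (_ | _) (_ | _)
        · exact (Real.mul_self_sqrt hqw.le).symm
        · exact (mul_comm _ _).trans hsqrt |>.symm
        · exact hsqrt.symm
        · exact (Real.mul_self_sqrt hqu.le).symm)
      (by rintro (_ | _); exacts [hgf ▸ hn, hgt ▸ hm])
      (by rintro (_ | _) <;> simp [blockFun, hgt, hgf] <;> omega)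
      (by rintro (_ | _) <;> simp [blockFun, hgt, hgf] <;> omega)
      (by
        rintro ⟨(_ | _), (_ | _)⟩ <;> simp [blockFun, hgt, hgf]
        · exact hnd
        · rw [mul_comm (n : ℝ)]; exact hnb
        · exact hnb
        · exact hna)
  refine ⟨W, hW0, hW, ?_⟩
  generalize (cellTables (fun i => bif g i then r₁ else r₂)
    fun i => bif g i then r₁ else r₂).card = M at hbound ⊢
  clear hW
  have hlow : (Real.exp (-(4 + 1 / ν)) / Q ^ 2) ^ 4 ≤ M * W * Q ^ (2 * p) := by
    simp only [Fintype.prod_prod_type, Fintype.prod_bool, Fintype.sum_prod_type, Fintype.sum_bool,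
      hgt, hgf, blockFun, cond_true, cond_false] at hbound
    have b1 := blockFactor_lower_bound hAn hn2 hν hm hm hmn hmn hAa hu
    have b2 := blockFactor_lower_bound hAn hn2 hν hm hn hmn le_rfl hAb hv
    have b3 := blockFactor_lower_bound hAn hn2 hν hn hm le_rfl hmn hAb hv
    have b4 := blockFactor_lower_bound hAn hn2 hν hn hn le_rfl le_rfl hAd hw
    rw [← hQ] at b1 b2 b3 b4
    have h0 : 0 ≤ Real.exp (-(4 + 1 / ν)) / Q ^ 2 := by positivity
    have hprod := mul_le_mul (mul_le_mul b1 b2 h0 (h0.trans b1)) (mul_le_mul b3 b4 h0 (h0.trans b3))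
      (mul_nonneg h0 h0) (mul_nonneg (h0.trans b1) (h0.trans b2))
    have h4 : (Real.exp (-(4 + 1 / ν)) / Q ^ 2) ^ 4 =
        Real.exp (-(4 + 1 / ν)) / Q ^ 2 * (Real.exp (-(4 + 1 / ν)) / Q ^ 2) *
          (Real.exp (-(4 + 1 / ν)) / Q ^ 2 * (Real.exp (-(4 + 1 / ν)) / Q ^ 2)) := by ring
    rw [h4]
    refine hprod.trans (hbound.trans ?_)
    gcongr
  rw [hp] at hlow
  exact neg_log_le_of_pow_le hn hmn hQ1 hlow

theorem sub_eq_geomRatio_sub_mul {z w : ℝ} (hz : 0 ≤ z) (hw : 0 ≤ w) :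
    z - w = (geomRatio z - geomRatio w) * ((1 + z) * (1 + w)) := by
  unfold geomRatio; field_simp; ring

theorem abs_geomRatio_sub_le {z w : ℝ} (hz : 0 ≤ z) (hw : 0 ≤ w) :
    |geomRatio z - geomRatio w| ≤ |z - w| := by
  rw [sub_eq_geomRatio_sub_mul hz hw, abs_mul]
  refine le_mul_of_one_le_right (abs_nonneg _) (le_trans ?_ (le_abs_self _))
  nlinarith [mul_nonneg hz hw]

/-- The typical table of the margins of the theorem, up to rounding, where `η` is the ratio of the
sizes of the two groups. -/
structure TypicalRegime (β C η m n u v w : ℝ) : Prop where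
  m_pos : 1 ≤ m
  η_pos : 0 < η
  η_le : η ≤ 1
  one_le : 1 ≤ n * η
  m_le : m ≤ n * η
  le_m : n * η ≤ 2 * m
  sub_one_le_m : n * η - 1 ≤ m
  u_pos : 0 < u
  v_pos : 0 < v
  w_pos : 0 < w
  top_le : m * u + n * v ≤ β * n
  le_top : β * n - 1 ≤ m * u + n * v
  bottom_le : m * v + n * w ≤ C * n
  le_bottom : C * n - 1 ≤ m * v + n * w
  balance : geomRatio u * geomRatio w = geomRatio v ^ 2

namespace TypicalRegime

variable {β C η m n u v w : ℝ}

theorem n_pos (h : TypicalRegime β C η m n u v w) : 0 < n :=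
  pos_of_mul_pos_left (lt_of_lt_of_le one_pos h.one_le) h.η_pos.le

theorem v_le (h : TypicalRegime β C η m n u v w) : v ≤ β := by
  have h1 := h.top_le
  have h2 : 0 ≤ m * u := mul_nonneg (by linarith [h.m_pos]) h.u_pos.le
  have h3 : n * v ≤ n * β := by linarith
  exact le_of_mul_le_mul_left h3 h.n_pos

theorem abs_w_sub_le (h : TypicalRegime β C η m n u v w) : |w - C| ≤ (1 + β) * η := by
  have hn := h.n_pos
  have hv := h.v_le
  have hv0 := h.v_pos
  have h1 : m * v ≤ n * η * β :=
    mul_le_mul h.m_le hv hv0.le (by nlinarith [h.one_le])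
  have h2 : 0 ≤ m * v := mul_nonneg (by linarith [h.m_pos]) hv0.le
  have h3 := h.bottom_le
  have h4 := h.le_bottom
  have h5 := h.one_le
  have hβ : 0 < β := hv0.trans_le hv
  rw [abs_le]
  constructor
  · refine le_of_mul_le_mul_left ?_ hn
    nlinarith
  · refine le_of_mul_le_mul_left ?_ hn
    have : 0 ≤ n * ((1 + β) * η) := by
      have := h.η_pos
      positivity
    nlinarith

/-- The parameter of the top left block, given estimates for the means of the other blocks. -/
theorem abs_geomRatio_topLeft_sub_le {R K₁ K₃ : ℝ} (hC : 0 < C)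
    (hRq : geomRatio R * geomRatio C = geomRatio β ^ 2) (hβ : 0 < β)
    (h : TypicalRegime β C η m n u v w) (hqw2 : geomRatio C / 2 ≤ geomRatio w)
    (hvβ : |v - β| ≤ K₁ * η) (hw1 : |w - C| ≤ K₃ * η) :
    |geomRatio u - geomRatio R| ≤ (2 * K₁ + K₃) * (2 / geomRatio C ^ 2) * η := by
  have hqC := geomRatio_pos hC
  have hqC1 := geomRatio_lt_one hC.le
  have hqβ := geomRatio_pos hβ
  have hqβ1 := geomRatio_lt_one hβ.le
  have hqw0 := geomRatio_pos h.w_pos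
  have hw1 := (abs_geomRatio_sub_le h.w_pos.le hC.le).trans hw1
  have hv1 : |geomRatio v - geomRatio β| ≤ K₁ * η :=
    (abs_geomRatio_sub_le h.v_pos.le hβ.le).trans hvβ
  have hv2 : |geomRatio v ^ 2 - geomRatio β ^ 2| ≤ 2 * (K₁ * η) := by
    have : geomRatio v ^ 2 - geomRatio β ^ 2 =
      (geomRatio v + geomRatio β) * (geomRatio v - geomRatio β) := by ring
    rw [this, abs_mul]
    have e1 := geomRatio_pos h.v_pos
    have e2 := geomRatio_lt_one h.v_pos.le
    refine mul_le_mul ?_ hv1 (abs_nonneg _) (by norm_num)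
    rw [abs_of_pos (by linarith)]
    linarith
  have hid : (geomRatio u - geomRatio R) * (geomRatio w * geomRatio C) =
      (geomRatio v ^ 2 - geomRatio β ^ 2) * geomRatio C -
        geomRatio β ^ 2 * (geomRatio w - geomRatio C) := by
    rw [← hRq, ← h.balance]; ring
  have hqq : geomRatio C ^ 2 / 2 ≤ geomRatio w * geomRatio C := by
    have := mul_le_mul_of_nonneg_right hqw2 hqC.le
    rw [pow_two]
    linarith
  have hnum : |(geomRatio v ^ 2 - geomRatio β ^ 2) * geomRatio C -
        geomRatio β ^ 2 * (geomRatio w - geomRatio C)| ≤ (2 * K₁ + K₃) * η := by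
    refine (abs_sub _ _).trans ?_
    rw [abs_mul, abs_mul, abs_of_pos hqC, abs_of_pos (by positivity : 0 < geomRatio β ^ 2)]
    have e1 : |geomRatio v ^ 2 - geomRatio β ^ 2| * geomRatio C ≤ 2 * (K₁ * η) * 1 := by
      have : 0 ≤ 2 * (K₁ * η) := (abs_nonneg _).trans hv2
      gcongr
    have e2 : geomRatio β ^ 2 * |geomRatio w - geomRatio C| ≤ 1 * (K₃ * η) := by
      gcongr
      exact pow_le_one₀ hqβ.le hqβ1.le
    linarith
  have hdiff : |geomRatio u - geomRatio R| ≤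
      (2 * K₁ + K₃) * (2 / geomRatio C ^ 2) * η := by
    rw [← hid, abs_mul, abs_of_pos (mul_pos hqw0 hqC)] at hnum
    have e1 := mul_le_mul_of_nonneg_left hqq (abs_nonneg (geomRatio u - geomRatio R))
    have e2 := e1.trans hnum
    have e3 : (2 * K₁ + K₃) * (2 / geomRatio C ^ 2) * η =
      ((2 * K₁ + K₃) * η) / (geomRatio C ^ 2 / 2) := by field_simp
    rw [e3, le_div_iff₀ (by positivity)]
    exact e2
  exact hdiff

/-- The typical table in the subcritical case. -/
theorem exists_subcritical_bound {β C : ℝ} (hβ : 0 < β) (hC : 0 < C)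
    (hlt : geomRatio β ^ 2 < geomRatio C) {R : ℝ} (hR : 0 ≤ R)
    (hRq : geomRatio R * geomRatio C = geomRatio β ^ 2) :
    ∃ K θ : ℝ, 0 < K ∧ 0 < θ ∧ ∀ η m n u v w, TypicalRegime β C η m n u v w → η ≤ θ →
      |v - β| ≤ K * η ∧ |u - R| ≤ K * η := by
  set D := geomRatio C - geomRatio β ^ 2 with hD
  have hD0 : 0 < D := sub_pos.mpr hlt
  have hqC := geomRatio_pos hC
  have hqC1 := geomRatio_lt_one hC.le
  have hqβ := geomRatio_pos hβ
  have hqβ1 := geomRatio_lt_one hβ.le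
  set U := 2 / D with hU
  have hU0 : 0 < U := by positivity
  set K₁ := 1 + U with hK₁
  set K₂ := (2 * K₁ + (1 + β)) * (2 / geomRatio C ^ 2) * ((1 + U) * (1 + R)) with hK₂
  have hK₂0 : 0 < K₂ := by positivity
  refine ⟨K₁ + K₂, D / (2 * (1 + β)), by positivity, by positivity, ?_⟩
  intro η m n u v w h hη
  have hη0 := h.η_pos
  have hn := h.n_pos
  have hw := h.abs_w_sub_le
  have hw1 : |geomRatio w - geomRatio C| ≤ (1 + β) * η :=
    (abs_geomRatio_sub_le h.w_pos.le hC.le).trans hw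
  have hqw : geomRatio C - D / 2 ≤ geomRatio w := by
    rw [le_div_iff₀ (by positivity)] at hη
    have := (abs_le.mp hw1).1
    linarith
  have hqv : geomRatio v ^ 2 ≤ geomRatio β ^ 2 :=
    pow_le_pow_left₀ (geomRatio_nonneg h.v_pos.le) (geomRatio_mono h.v_pos.le h.v_le) 2
  have hqu := geomRatio_pos h.u_pos
  have hqu1 := geomRatio_lt_one h.u_pos.le
  have huU : u ≤ U := by
    have e1 := h.balance
    have e2 := one_sub_geomRatio h.u_pos.le
    have e3 : D / 2 ≤ 1 - geomRatio u := by
      have : geomRatio u * (geomRatio C - D / 2) ≤ geomRatio u * geomRatio w := by gcongr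
      have : (geomRatio C - D / 2) * (1 - geomRatio u) ≥ D / 2 := by
        rw [mul_sub, mul_one, mul_comm _ (geomRatio u)]
        linarith
      have e4 : geomRatio C - D / 2 ≤ 1 := by linarith
      nlinarith
    rw [e2, div_le_div_iff₀ (by norm_num) (by linarith [h.u_pos])] at e3
    rw [hU, le_div_iff₀ hD0]
    nlinarith
  have hvβ : |v - β| ≤ K₁ * η := by
    have e1 := h.le_top
    have e2 : m * u ≤ n * η * U :=
      mul_le_mul h.m_le huU h.u_pos.le (by nlinarith [h.one_le])
    have e3 := h.one_le
    have e4 := h.v_le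
    rw [abs_le]
    constructor
    · refine le_of_mul_le_mul_left ?_ hn
      nlinarith
    · have : 0 ≤ K₁ * η := by positivity
      linarith
  refine ⟨hvβ.trans (by gcongr; linarith), ?_⟩
  have hqw0 := geomRatio_pos h.w_pos
  have hqw2 : geomRatio C / 2 ≤ geomRatio w := by
    have : 0 ≤ geomRatio β ^ 2 := by positivity
    linarith
  have hdiff := abs_geomRatio_topLeft_sub_le hC hRq hβ h hqw2 hvβ hw
  rw [sub_eq_geomRatio_sub_mul h.u_pos.le hR, abs_mul]
  have hu0 := h.u_pos
  rw [abs_of_pos (by positivity : 0 < (1 + u) * (1 + R))]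
  calc |geomRatio u - geomRatio R| * ((1 + u) * (1 + R))
      ≤ (2 * K₁ + (1 + β)) * (2 / geomRatio C ^ 2) * η * ((1 + U) * (1 + R)) := by gcongr
    _ = K₂ * η := by rw [hK₂]; ring
    _ ≤ _ := by gcongr; linarith

theorem abs_sub_mul_le_abs_sq_sub {a b : ℝ} (ha : 0 ≤ a) (hb : 0 ≤ b) :
    |a - b| * b ≤ |a ^ 2 - b ^ 2| := by
  have : a ^ 2 - b ^ 2 = (a - b) * (a + b) := by ring
  rw [this, abs_mul, abs_of_nonneg (by linarith : 0 ≤ a + b)]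
  gcongr
  linarith

/-- The typical table in the supercritical case. -/
theorem exists_supercritical_bound {β C v₀ : ℝ} (hC : 0 < C) (hv₀ : 0 < v₀) (hlt : v₀ < β)
    (hq : geomRatio v₀ ^ 2 = geomRatio C) :
    ∃ K θ : ℝ, 0 < K ∧ 0 < θ ∧ ∀ η m n u v w, TypicalRegime β C η m n u v w → η ≤ θ →
      |v - v₀| ≤ K * η ∧ (1 ≤ n * η ^ 2 → |u - (β - v₀) / η| ≤ K) := by
  have hβ : 0 < β := hv₀.trans hlt
  have hqv₀ := geomRatio_pos hv₀
  set A := (1 + β) * (1 + v₀) / geomRatio v₀ with hA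
  have hA0 : 0 < A := by positivity
  set K₁ := 1 + β with hK₁
  set d := β - v₀ with hd
  have hd0 : 0 < d := sub_pos.mpr hlt
  set K₄ := K₁ + 2 / d with hK₄
  have hK₄0 : 0 < K₄ := by positivity
  have hK₁0 : 0 < K₁ := by positivity
  refine ⟨A * K₄ + (1 + 2 * (A * K₄) + 2 * d), d / (2 * (A * K₁ + 1)), by positivity,
    by positivity, ?_⟩
  intro η m n u v w h hη
  have hη0 := h.η_pos
  have hn := h.n_pos
  have hm : 0 < m := by linarith [h.m_pos]
  have hv0 := h.v_pos
  have hw1 : |geomRatio w - geomRatio C| ≤ K₁ * η :=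
    (abs_geomRatio_sub_le h.w_pos.le hC.le).trans h.abs_w_sub_le
  have hw1' := abs_le.mp hw1
  have hqu := geomRatio_pos h.u_pos
  have hqu1 := geomRatio_lt_one h.u_pos.le
  have hqw := geomRatio_pos h.w_pos
  have hqw1 := geomRatio_lt_one h.w_pos.le
  have hqv := geomRatio_pos h.v_pos
  have hbal := h.balance
  have hscale : ∀ x, geomRatio v - geomRatio v₀ ≤ x / geomRatio v₀ → 0 ≤ x → v - v₀ ≤ A * x := by
    intro x hx hx0
    rw [sub_eq_geomRatio_sub_mul hv0.le hv₀.le]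
    calc (geomRatio v - geomRatio v₀) * ((1 + v) * (1 + v₀))
        ≤ x / geomRatio v₀ * ((1 + v) * (1 + v₀)) := by gcongr
      _ ≤ x / geomRatio v₀ * ((1 + β) * (1 + v₀)) := by gcongr; exact h.v_le
      _ = _ := by rw [hA]; ring
  have hup : v - v₀ ≤ A * (K₁ * η) := by
    refine hscale _ ?_ (by positivity)
    rw [le_div_iff₀ hqv₀]
    rcases le_total (geomRatio v) (geomRatio v₀) with hle | hle
    · have : 0 ≤ K₁ * η := by positivity
      nlinarith
    · nlinarith
  have hu : d / (2 * η) ≤ u := by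
    rw [le_div_iff₀ (by positivity)] at hη
    have e1 := h.le_top
    have e2 : n * d ≤ 2 * (m * u) := by
      have f1 : n * (v - v₀) ≤ n * (A * (K₁ * η)) := by gcongr
      have f2 : n * (η * (2 * (A * K₁ + 1))) ≤ n * d := by gcongr
      have f3 := h.one_le
      nlinarith
    have e3 : m * u ≤ n * η * u := by
      gcongr
      · exact h.u_pos.le
      · exact h.m_le
    rw [div_le_iff₀ (by positivity)]
    refine le_of_mul_le_mul_left ?_ hn
    nlinarith
  have hqu2 : 1 - geomRatio u ≤ 2 / d * η := by
    rw [one_sub_geomRatio h.u_pos.le]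
    have e1 : 0 < d / (2 * η) := by positivity
    calc 1 / (1 + u) ≤ 1 / (d / (2 * η)) := by gcongr; linarith
      _ = _ := by field_simp
  have hsq : |geomRatio v ^ 2 - geomRatio v₀ ^ 2| ≤ K₄ * η := by
    rw [hq, ← hbal, abs_le]
    have e1 : geomRatio w * (1 - geomRatio u) ≤ 2 / d * η := by
      have : 0 ≤ 1 - geomRatio u := by linarith
      nlinarith
    have e2 : 0 ≤ geomRatio w * (1 - geomRatio u) := mul_nonneg hqw.le (by linarith)
    have e3 : 0 ≤ 2 / d * η := by positivity
    have e4 : K₄ * η = K₁ * η + 2 / d * η := by rw [hK₄]; ring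
    constructor <;> nlinarith
  have hqd : |geomRatio v - geomRatio v₀| ≤ K₄ * η / geomRatio v₀ := by
    rw [le_div_iff₀ hqv₀]
    exact (abs_sub_mul_le_abs_sq_sub hqv.le hqv₀.le).trans hsq
  have hvv : |v - v₀| ≤ A * K₄ * η := by
    rw [sub_eq_geomRatio_sub_mul hv0.le hv₀.le, abs_mul,
      abs_of_pos (by positivity : 0 < (1 + v) * (1 + v₀))]
    calc |geomRatio v - geomRatio v₀| * ((1 + v) * (1 + v₀))
        ≤ K₄ * η / geomRatio v₀ * ((1 + β) * (1 + v₀)) := by gcongr; exact h.v_le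
      _ = _ := by rw [hA]; ring
  refine ⟨hvv.trans (by gcongr; have : 0 < 1 + 2 * (A * K₄) + 2 * d := by positivity
                        linarith), fun hnη => ?_⟩
  obtain ⟨t, ht⟩ : ∃ t, t = m * u + n * v - β * n := ⟨_, rfl⟩
  have ht1 : |t| ≤ 1 := by
    rw [abs_le]
    constructor <;> linarith [h.top_le, h.le_top]
  have hid : (u - d / η) * m = t - n * (v - v₀) + d * ((n * η - m) / η) := by
    rw [ht, hd]; field_simp; ring
  have e1 : |n * (v - v₀)| ≤ 2 * m * (A * K₄) := by
    rw [abs_mul, abs_of_pos hn]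
    calc n * |v - v₀| ≤ n * (A * K₄ * η) := by gcongr
      _ = n * η * (A * K₄) := by ring
      _ ≤ _ := mul_le_mul_of_nonneg_right h.le_m (by positivity)
  have e2 : |d * ((n * η - m) / η)| ≤ 2 * m * d := by
    have f1 : 0 ≤ n * η - m := by linarith [h.m_le]
    rw [abs_of_nonneg (by positivity)]
    have f2 : (n * η - m) / η ≤ 2 * m := by
      rw [div_le_iff₀ hη0]
      have f3 : η * 1 ≤ η * (n * η) := by gcongr; exact h.one_le
      have f4 := mul_le_mul_of_nonneg_right h.le_m hη0.le
      have f5 : n * η * η = n * η ^ 2 := by ring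
      linarith [h.sub_one_le_m]
    have := mul_le_mul_of_nonneg_left f2 hd0.le
    linarith
  have e3 : |u - d / η| * m ≤ (1 + 2 * (A * K₄) + 2 * d) * m := by
    rw [← abs_of_pos hm, ← abs_mul, abs_of_pos hm, hid]
    refine (abs_add_le _ _).trans ((add_le_add_left (abs_sub _ _) _).trans ?_)
    have := h.m_pos
    linarith
  refine (le_of_mul_le_mul_right e3 hm).trans ?_
  have : 0 < A * K₄ := by positivity
  linarith

end TypicalRegime

theorem geomRatio_critB_sq {C : ℝ} (hC : 0 < C) :
    geomRatio (critB C * C) ^ 2 = geomRatio C := by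
  have h1 : √(1 + 1 / C) ^ 2 = 1 + 1 / C := Real.sq_sqrt (by positivity)
  have h0 : 0 ≤ √(1 + 1 / C) := Real.sqrt_nonneg _
  unfold critB geomRatio
  set s := √(1 + 1 / C) with hs
  have hC' : C * (s ^ 2 - 1) = 1 := by rw [h1]; field_simp; ring
  rw [div_pow, div_eq_div_iff (by positivity) (by positivity)]
  have e : 1 + (1 + s) * C = C * s * (1 + s) := by linarith
  rw [e]
  have : (1 + C) = C * s ^ 2 := by linarith
  rw [this]
  ring

theorem geomRatio_topLeft {B C : ℝ} (hB : 0 < B) (hC : 0 < C) (hlt : B < critB C) :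
    0 < B ^ 2 * (1 + C) / ((critB C - B) * (B + critB C - 2)) ∧
      geomRatio (B ^ 2 * (1 + C) / ((critB C - B) * (B + critB C - 2))) * geomRatio C =
        geomRatio (B * C) ^ 2 := by
  have h1 : √(1 + 1 / C) ^ 2 = 1 + 1 / C := Real.sq_sqrt (by positivity)
  have h2 : 1 < √(1 + 1 / C) := by
    rw [Real.lt_sqrt (by norm_num)]
    have : 0 < 1 / C := by positivity
    linarith
  unfold critB at hlt ⊢
  set s := √(1 + 1 / C) with hs
  have hD : 0 < (1 + s - B) * (B + (1 + s) - 2) := mul_pos (by linarith) (by linarith)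
  have hDe : C * ((1 + s - B) * (B + (1 + s) - 2)) = 1 + 2 * B * C - B ^ 2 * C := by
    have : C * s ^ 2 = C + 1 := by rw [h1]; field_simp
    linear_combination this
  refine ⟨by positivity, ?_⟩
  set D := (1 + s - B) * (B + (1 + s) - 2) with hDd
  unfold geomRatio
  have e : 1 + B ^ 2 * (1 + C) / D = (D + B ^ 2 * (1 + C)) / D := by field_simp
  have e2 : C * (D + B ^ 2 * (1 + C)) = (1 + B * C) ^ 2 := by
    rw [mul_add, hDe]; ring
  rw [e, div_pow, ← e2]
  field_simp

/-- The label of the group of a row or column: `true` for the top rows. -/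
def topLabel (n : ℕ) (δ : ℝ) (i : Fin (numTop n δ + n)) : Bool := decide ((i : ℕ) < numTop n δ)

theorem topLabel_eq_true {n : ℕ} {δ : ℝ} {i : Fin (numTop n δ + n)} (h : (i : ℕ) < numTop n δ) :
    topLabel n δ i = true := by
  simp [topLabel, h]

theorem topLabel_eq_false {n : ℕ} {δ : ℝ} {i : Fin (numTop n δ + n)} (h : numTop n δ ≤ (i : ℕ)) :
    topLabel n δ i = false := by
  simp [topLabel, h]

theorem card_topLabel_true (n : ℕ) (δ : ℝ) :
    (Finset.univ.filter fun i => topLabel n δ i = true).card = numTop n δ := by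
  simp only [topLabel, decide_eq_true_eq, Fin.card_filter_val_lt]
  omega

theorem card_topLabel_false (n : ℕ) (δ : ℝ) :
    (Finset.univ.filter fun i => topLabel n δ i = false).card = n := by
  have h := Finset.card_filter_add_card_filter_not (s := (Finset.univ : Finset (Fin (numTop n δ + n))))
    (fun i => topLabel n δ i = true)
  rw [card_topLabel_true, Finset.card_univ, Fintype.card_fin] at h
  simp only [Bool.not_eq_true] at h
  omega

theorem margin_eq (n : ℕ) (δ B C : ℝ) :
    margin n δ B C = fun i => bif topLabel n δ i then ⌊B * C * n⌋₊ else ⌊C * n⌋₊ := by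
  funext i
  by_cases h : (i : ℕ) < numTop n δ <;> simp [margin, topLabel, h]

theorem entryMass_eq (n : ℕ) (δ B C : ℝ) (i j : Fin (numTop n δ + n)) :
    entryMass n δ B C i j = fun k =>
      (((cellTables (margin n δ B C) (margin n δ B C)).filter fun T => T (i, j) = k).card : ℝ) /
        (cellTables (margin n δ B C) (margin n δ B C)).card := by
  funext k
  exact uniformTable_real_eq _ i j k

theorem cellTables_self_nonempty {p : ℕ} (r : Fin p → ℕ) : (cellTables r r).Nonempty := by
  rw [← Finset.card_pos, card_cellTables, Set.ncard_pos (tables_finite r r)]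
  exact tables_self_nonempty r

theorem dTV_entryMass_le_two (n : ℕ) (δ B C : ℝ) (i j : Fin (numTop n δ + n)) {z : ℝ}
    (hz : 0 ≤ z) : dTV (entryMass n δ B C i j) (geomMass z) ≤ 2 := by
  rw [entryMass_eq]
  exact dTV_relFreq_le_two (cellTables_self_nonempty _) (fun T => T (i, j)) hz

theorem dTV_entryMass_triangle (n : ℕ) (δ B C : ℝ) (i j : Fin (numTop n δ + n)) {z R : ℝ}
    (hz : 0 ≤ z) (hR : 0 ≤ R) :
    dTV (entryMass n δ B C i j) (geomMass R) ≤
      dTV (entryMass n δ B C i j) (geomMass z) + 2 * |z - R| / (1 + R) := by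
  rw [entryMass_eq]
  exact dTV_relFreq_triangle (cellTables (margin n δ B C) (margin n δ B C))
    (fun T => T (i, j)) hz hR

theorem numTop_bounds {n : ℕ} {δ : ℝ} (hn : 1 ≤ n) (hδ : 0 ≤ δ) (hδ' : δ ≤ 1) :
    1 ≤ numTop n δ ∧ numTop n δ ≤ n ∧ (numTop n δ : ℝ) ≤ n * (n : ℝ) ^ (δ - 1) ∧
      n * (n : ℝ) ^ (δ - 1) - 1 ≤ numTop n δ ∧ n * (n : ℝ) ^ (δ - 1) ≤ 2 * numTop n δ := by
  have hn' : (1 : ℝ) ≤ n := by exact_mod_cast hn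
  have hn0 : (0 : ℝ) < n := by linarith
  have e : n * (n : ℝ) ^ (δ - 1) = (n : ℝ) ^ δ := by
    rw [Real.rpow_sub_one hn0.ne']; field_simp
  rw [e]
  have h1 : (1 : ℝ) ≤ (n : ℝ) ^ δ := Real.one_le_rpow hn' hδ
  have h2 : (n : ℝ) ^ δ ≤ n := by
    calc (n : ℝ) ^ δ ≤ (n : ℝ) ^ (1 : ℝ) := Real.rpow_le_rpow_of_exponent_le hn' hδ'
      _ = n := Real.rpow_one _
  have h3 := Nat.floor_le (by linarith : (0 : ℝ) ≤ (n : ℝ) ^ δ)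
  have h4 := Nat.lt_floor_add_one ((n : ℝ) ^ δ)
  have h5 : 1 ≤ ⌊(n : ℝ) ^ δ⌋₊ := Nat.le_floor (by simpa using h1)
  have h5' : (1 : ℝ) ≤ ⌊(n : ℝ) ^ δ⌋₊ := by exact_mod_cast h5
  unfold numTop
  refine ⟨h5, ?_, h3, by linarith, by linarith⟩
  have : (⌊(n : ℝ) ^ δ⌋₊ : ℝ) ≤ n := h3.trans h2
  exact_mod_cast this

theorem exists_typicalRegime {B C δ : ℝ} {n : ℕ} (hB : 0 < B) (hC : 0 < C) (hδ : 0 ≤ δ)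
    (hδ' : δ ≤ 1) (hn : 1 ≤ n) (hn₁ : 2 / (B * C) ≤ n) (hn₂ : 2 / C ≤ n) :
    ∃ u v w, TypicalRegime (B * C) C ((n : ℝ) ^ (δ - 1)) (numTop n δ) n u v w ∧
      IsTypical (numTop n δ) n ⌊B * C * n⌋₊ ⌊C * n⌋₊ u v w ∧
      geomRatio (min (B * C) C / 4) ^ 2 ≤ u ∧ geomRatio (min (B * C) C / 4) ^ 2 ≤ v ∧
        geomRatio (min (B * C) C / 4) ^ 2 ≤ w := by
  obtain ⟨h1, h2, h3, h4, h5⟩ := numTop_bounds hn hδ hδ'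
  have hn' : (1 : ℝ) ≤ n := by exact_mod_cast hn
  have h1' : (1 : ℝ) ≤ numTop n δ := by exact_mod_cast h1
  have h2' : (numTop n δ : ℝ) ≤ n := by exact_mod_cast h2
  have hBC : 0 < B * C := mul_pos hB hC
  have f1 := Nat.floor_le (by positivity : (0 : ℝ) ≤ B * C * n)
  have f2 := Nat.lt_floor_add_one (B * C * n)
  have f3 := Nat.floor_le (by positivity : (0 : ℝ) ≤ C * n)
  have f4 := Nat.lt_floor_add_one (C * n)
  rw [div_le_iff₀ (by positivity)] at hn₁ hn₂
  have hμ : 0 < min (B * C) C / 4 := by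
    have := lt_min hBC hC
    linarith
  have k1 : 2 * (min (B * C) C / 4) * n ≤ B * C / 2 * n := by
    gcongr; linarith [min_le_left (B * C) C]
  have k2 : 2 * (min (B * C) C / 4) * n ≤ C / 2 * n := by
    gcongr; linarith [min_le_right (B * C) C]
  obtain ⟨u, v, w, h, hu, hv, hw⟩ := exists_isTypical (m := numTop n δ) (n := n)
    (r₁ := ⌊B * C * n⌋₊) (r₂ := ⌊C * n⌋₊) (by linarith) h2' hμ (by linarith) (by linarith)
  refine ⟨u, v, w, ?_, h, hu, hv, hw⟩
  have hη : (n : ℝ) ^ (δ - 1) ≤ 1 := Real.rpow_le_one_of_one_le_of_nonpos hn' (by linarith)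
  exact
    { m_pos := h1'
      η_pos := Real.rpow_pos_of_pos (by linarith) _
      η_le := hη
      one_le := h1'.trans h3
      m_le := h3
      le_m := h5
      sub_one_le_m := h4
      u_pos := h.u_pos
      v_pos := h.v_pos
      w_pos := h.w_pos
      top_le := by rw [h.top]; exact f1
      le_top := by rw [h.top]; linarith
      bottom_le := by rw [h.bottom]; exact f3
      le_bottom := by rw [h.bottom]; linarith
      balance := h.balance }

/-- The entries of the uniform random table are close to geometric random variables, with the means
given by the typical table. -/
theorem exists_dTV_typical_bound {B C ε : ℝ} (hB : 0 < B) (hC : 0 < C) (hε : 0 < ε) :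
    ∃ Γ : ℝ, 0 < Γ ∧ ∃ n₀ : ℕ, ∀ δ : ℝ, 0 ≤ δ → δ ≤ 1 → ∀ n : ℕ, n₀ ≤ n → 1 ≤ n →
      ∃ u v w, TypicalRegime (B * C) C ((n : ℝ) ^ (δ - 1)) (numTop n δ) n u v w ∧
        ∀ (i j : Fin (numTop n δ + n)) (τ c : ℝ), 0 < c →
          c * (n : ℝ) ^ (1 + τ) ≤ (bif topLabel n δ i then (numTop n δ : ℝ) else n) *
            (bif topLabel n δ j then (numTop n δ : ℝ) else n) →
          dTV (entryMass n δ B C i j)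
            (geomMass (blockFun u v w (topLabel n δ i) (topLabel n δ j))) ≤
            (4 + Γ / c) * (n : ℝ) ^ (-(τ / 2) + ε) := by
  have hBC : 0 < B * C := mul_pos hB hC
  set ν := geomRatio (min (B * C) C / 4) ^ 2 with hν
  have hν0 : 0 < ν := by
    have := lt_min hBC hC
    have := geomRatio_pos (by linarith : 0 < min (B * C) C / 4)
    positivity
  set A := B * C + C + 1 with hA
  have hA1 : 1 ≤ A := by rw [hA]; linarith
  have hlogA : 0 ≤ Real.log (5 * A) := Real.log_nonneg (by linarith)
  refine ⟨16 + 4 / ν + 12 * (Real.log (5 * A) + 1 / ε), by positivity,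
    ⌈2 / (B * C)⌉₊ + ⌈2 / C⌉₊, ?_⟩
  set Γ := 16 + 4 / ν + 12 * (Real.log (5 * A) + 1 / ε) with hΓ
  intro δ hδ hδ' n hn₀ hn
  have hn' : (1 : ℝ) ≤ n := by exact_mod_cast hn
  have hn0 : (0 : ℝ) < n := by linarith
  have hn₁ : 2 / (B * C) ≤ n := Nat.ceil_le.mp (by omega)
  have hn₂ : 2 / C ≤ n := Nat.ceil_le.mp (by omega)
  obtain ⟨u, v, w, hreg, htyp, hu, hv, hw⟩ := exists_typicalRegime hB hC hδ hδ' hn hn₁ hn₂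
  refine ⟨u, v, w, hreg, ?_⟩
  obtain ⟨h1, h2, -, -, -⟩ := numTop_bounds hn hδ hδ'
  have f1 := Nat.floor_le (by positivity : (0 : ℝ) ≤ B * C * n)
  have f3 := Nat.floor_le (by positivity : (0 : ℝ) ≤ C * n)
  obtain ⟨W, hW0, hW, hlog⟩ := exists_weight_two_groups (g := topLabel n δ) (A := A) h1 h2 rfl
    (card_topLabel_true n δ) (card_topLabel_false n δ) htyp hA1
    (f1.trans (by gcongr; linarith)) (f3.trans (by gcongr; linarith)) hν0 hu hv hw
  rw [← margin_eq] at hW hlog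
  intro i j τ c hc hcard
  set M := cellTables (margin n δ B C) (margin n δ B C) with hM
  have hΓlog : -Real.log (M.card * W) ≤ Γ * (n : ℝ) ^ (1 + 2 * ε) := by
    refine hlog.trans ?_
    have e1 : Real.log (5 * A * (n : ℝ) ^ 2) = Real.log (5 * A) + 2 * Real.log n := by
      rw [Real.log_mul (by positivity) (by positivity), Real.log_pow]; push_cast; ring
    have e2 := Real.log_le_rpow_div hn0.le (by positivity : 0 < 2 * ε)
    have e3 : (1 : ℝ) ≤ (n : ℝ) ^ (2 * ε) := Real.one_le_rpow hn' (by positivity)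
    have e4 : Real.log (5 * A * (n : ℝ) ^ 2) ≤ (Real.log (5 * A) + 1 / ε) * (n : ℝ) ^ (2 * ε) := by
      rw [e1]
      have : 2 * ((n : ℝ) ^ (2 * ε) / (2 * ε)) = 1 / ε * (n : ℝ) ^ (2 * ε) := by field_simp
      nlinarith
    have e5 : (n : ℝ) ^ (1 + 2 * ε) = n * (n : ℝ) ^ (2 * ε) := by
      rw [Real.rpow_add hn0, Real.rpow_one]
    have e6 : 1 ≤ n * (n : ℝ) ^ (2 * ε) := by nlinarith
    have e7 : (0 : ℝ) < 16 + 4 / ν := by positivity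
    rw [e5, hΓ]
    calc 16 + 4 / ν + 12 * n * Real.log (5 * A * (n : ℝ) ^ 2)
        ≤ (16 + 4 / ν) * (n * (n : ℝ) ^ (2 * ε)) +
          12 * n * ((Real.log (5 * A) + 1 / ε) * (n : ℝ) ^ (2 * ε)) := by
          gcongr
          exact le_mul_of_one_le_right e7.le e6
      _ = _ := by ring
  have hΓ0 : 0 < Γ := by positivity
  have hz : 0 ≤ blockFun u v w (topLabel n δ i) (topLabel n δ j) := by
    cases topLabel n δ i <;> cases topLabel n δ j
    exacts [hreg.w_pos.le, hreg.v_pos.le, hreg.v_pos.le, hreg.u_pos.le]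
  set s := (n : ℝ) ^ (-(τ / 2) + ε) with hs
  have hs0 : 0 < s := Real.rpow_pos_of_pos hn0 _
  rcases le_total s (1 / 2) with hs' | hs'
  · set S : Finset (Fin (numTop n δ + n) × Fin (numTop n δ + n)) :=
      Finset.univ.filter fun c => (topLabel n δ c.1, topLabel n δ c.2) =
        (topLabel n δ i, topLabel n δ j) with hS
    have hScard : c * (n : ℝ) ^ (1 + τ) ≤ S.card := by
      refine hcard.trans (le_of_eq ?_)
      rw [hS, card_block]
      cases topLabel n δ i <;> cases topLabel n δ j <;>
        simp [card_topLabel_true, card_topLabel_false]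
    have hmem : ∀ c ∈ S, topLabel n δ c.1 = topLabel n δ i ∧ topLabel n δ c.2 = topLabel n δ j := by
      intro c hc
      simpa [hS] using hc
    have hmar : ∀ a b, topLabel n δ a = topLabel n δ b → margin n δ B C a = margin n δ B C b := by
      intro a b hab
      simp only [margin_eq, hab]
    have key := dTV_relFreq_le (M := M) (cellTables_self_nonempty _)
      (Z := fun c => blockFun u v w (topLabel n δ c.1) (topLabel n δ c.2))
      (by
        intro c
        cases topLabel n δ c.1 <;> cases topLabel n δ c.2
        exacts [hreg.w_pos.le, hreg.v_pos.le, hreg.v_pos.le, hreg.u_pos.le]) hW0 hW S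
      (z := blockFun u v w (topLabel n δ i) (topLabel n δ j))
      (by
        intro c hc
        simp only [(hmem c hc).1, (hmem c hc).2]) (c₀ := (i, j)) (by simp [hS])
      (by
        rintro ⟨a, b⟩ hc k
        exact card_filter_cellTables_eq (hmar _ _ (hmem _ hc).1) (hmar _ _ (hmem _ hc).2) k)
      hs0 hs'
    rw [entryMass_eq]
    refine key.trans ?_
    have hnτ : 0 < (n : ℝ) ^ (1 + τ) := Real.rpow_pos_of_pos hn0 _
    have hSpos : (0 : ℝ) < S.card := lt_of_lt_of_le (by positivity) hScard
    have e1 : -Real.log (M.card * W) / (s * S.card) ≤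
        Γ * (n : ℝ) ^ (1 + 2 * ε) / (s * (c * (n : ℝ) ^ (1 + τ))) := by
      calc -Real.log (M.card * W) / (s * S.card)
          ≤ Γ * (n : ℝ) ^ (1 + 2 * ε) / (s * S.card) :=
            div_le_div_of_nonneg_right hΓlog (mul_pos hs0 hSpos).le
        _ ≤ _ := by
            refine div_le_div_of_nonneg_left (by positivity) (by positivity) ?_
            exact mul_le_mul_of_nonneg_left hScard hs0.le
    have e2 : (n : ℝ) ^ (1 + 2 * ε) = s * s * (n : ℝ) ^ (1 + τ) := by
      rw [hs, ← Real.rpow_add hn0, ← Real.rpow_add hn0]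
      congr 1
      ring
    have e3 : Γ * (n : ℝ) ^ (1 + 2 * ε) / (s * (c * (n : ℝ) ^ (1 + τ))) = Γ / c * s := by
      rw [e2]; field_simp
    rw [e3, neg_div] at e1
    linarith
  · refine (dTV_entryMass_le_two n δ B C i j hz).trans ?_
    have : 0 < Γ / c * s := by positivity
    linarith

theorem exists_bound_of_eventually {δ e : ℝ} (hδ : 0 ≤ δ) (P : ℕ → ℝ → Prop)
    (h2 : ∀ n x, 1 ≤ n → P n x → x ≤ 2)
    (h : ∃ K : ℝ, ∃ n₀ : ℕ, ∀ n x, n₀ ≤ n → 1 ≤ n → P n x →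
      x ≤ K * ((n : ℝ) ^ (δ - 1) + (n : ℝ) ^ e)) :
    ∃ K : ℝ, ∀ n x, 1 ≤ n → P n x → x ≤ K * ((n : ℝ) ^ (δ - 1) + (n : ℝ) ^ e) := by
  obtain ⟨K, n₀, h⟩ := h
  refine ⟨max K (2 * n₀), fun n x hn hP => ?_⟩
  have hn' : (1 : ℝ) ≤ n := by exact_mod_cast hn
  have hn0 : (0 : ℝ) < n := by linarith
  have hpos : 0 < (n : ℝ) ^ e := Real.rpow_pos_of_pos hn0 _
  have hpos' : 0 < (n : ℝ) ^ (δ - 1) := Real.rpow_pos_of_pos hn0 _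
  rcases le_total n₀ n with hle | hle
  · exact (h n x hle hn hP).trans (by gcongr; exact le_max_left _ _)
  · have e1 : (n : ℝ)⁻¹ ≤ (n : ℝ) ^ (δ - 1) := by
      rw [← Real.rpow_neg_one]
      exact Real.rpow_le_rpow_of_exponent_le hn' (by linarith)
    have e2 : (n : ℝ) ≤ n₀ := by exact_mod_cast hle
    calc x ≤ 2 := h2 n x hn hP
      _ = 2 * n * (n : ℝ)⁻¹ := by field_simp
      _ ≤ 2 * n₀ * ((n : ℝ) ^ (δ - 1) + (n : ℝ) ^ e) := by
          gcongr; linarith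
      _ ≤ _ := by gcongr; exact le_max_right _ _

theorem exists_rpow_le {a θ : ℝ} (ha : a < 0) (hθ : 0 < θ) :
    ∃ n₀ : ℕ, ∀ n : ℕ, n₀ ≤ n → (n : ℝ) ^ a ≤ θ := by
  have h : Filter.Tendsto (fun n : ℕ => (n : ℝ) ^ a) Filter.atTop (nhds 0) := by
    have := (tendsto_rpow_neg_atTop (by linarith : 0 < -a)).comp tendsto_natCast_atTop_atTop
    simpa [Function.comp_def] using this
  exact Filter.eventually_atTop.mp (h.eventually_le_const hθ)

theorem critB_pos (C : ℝ) : 0 < critB C := by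
  have := Real.sqrt_nonneg (1 + 1 / C)
  unfold critB
  linarith

theorem rpow_le_block_size {n : ℕ} {δ : ℝ} (hn : 1 ≤ n) (hδ : 0 ≤ δ) (hδ' : δ ≤ 1) :
    1 / 2 * (n : ℝ) ^ (1 + δ) ≤ numTop n δ * n ∧
      1 / 4 * (n : ℝ) ^ (1 + (2 * δ - 1)) ≤ (numTop n δ : ℝ) * numTop n δ := by
  have hn0 : (0 : ℝ) < n := by exact_mod_cast hn
  have h5 := (numTop_bounds hn hδ hδ').2.2.2.2
  have e : n * (n : ℝ) ^ (δ - 1) = (n : ℝ) ^ δ := by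
    rw [Real.rpow_sub_one hn0.ne']; field_simp
  rw [e] at h5
  have hpos : 0 < (n : ℝ) ^ δ := Real.rpow_pos_of_pos hn0 _
  constructor
  · rw [Real.rpow_add hn0, Real.rpow_one]
    nlinarith
  · have : (n : ℝ) ^ (1 + (2 * δ - 1)) = (n : ℝ) ^ δ * (n : ℝ) ^ δ := by
      rw [← Real.rpow_add hn0]; congr 1; ring
    rw [this]
    nlinarith

theorem two_mul_abs_div_le {z R x : ℝ} (hR : 0 ≤ R) (h : |z - R| ≤ x) :
    2 * |z - R| / (1 + R) ≤ 2 * x := by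
  have h1 : 2 * |z - R| / (1 + R) ≤ 2 * |z - R| :=
    div_le_self (by positivity) (by linarith)
  linarith

/-- The bottom right block. -/
theorem exists_dTV_bottomRight_bound {δ B C ε : ℝ} (hB : 0 < B) (hC : 0 < C) (hε : 0 < ε)
    (hδ : 0 ≤ δ) (hδ' : δ ≤ 1) :
    ∃ K : ℝ, ∀ n : ℕ, 1 ≤ n → ∀ i j : Fin (numTop n δ + n),
      numTop n δ ≤ (i : ℕ) → numTop n δ ≤ (j : ℕ) →
      dTV (entryMass n δ B C i j) (geomMass C) ≤
        K * ((n : ℝ) ^ (δ - 1) + (n : ℝ) ^ (-(1 / 2) + ε)) := by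
  refine Exists.imp ?_ (exists_bound_of_eventually (e := -(1 / 2) + ε) hδ
    (fun n x => ∃ i j : Fin (numTop n δ + n), numTop n δ ≤ (i : ℕ) ∧ numTop n δ ≤ (j : ℕ) ∧
      x = dTV (entryMass n δ B C i j) (geomMass C)) ?_ ?_)
  · exact fun K hK n hn i j hi hj => hK n _ hn ⟨i, j, hi, hj, rfl⟩
  · rintro n x - ⟨i, j, -, -, rfl⟩
    exact dTV_entryMass_le_two n δ B C i j hC.le
  obtain ⟨Γ, hΓ, n₀, h⟩ := exists_dTV_typical_bound hB hC hε
  refine ⟨max (2 * (1 + B * C)) (4 + Γ / 1), n₀, ?_⟩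
  rintro n x hn₀ hn ⟨i, j, hi, hj, rfl⟩
  have hn0 : (0 : ℝ) < n := by exact_mod_cast hn
  obtain ⟨u, v, w, hreg, hbound⟩ := h δ hδ hδ' n hn₀ hn
  have h1 := hbound i j 1 1 one_pos (by
    rw [topLabel_eq_false hi, topLabel_eq_false hj, one_mul, cond_false, Real.rpow_add hn0,
      Real.rpow_one])
  rw [topLabel_eq_false hi, topLabel_eq_false hj] at h1
  refine (dTV_entryMass_triangle n δ B C i j (z := w) hreg.w_pos.le hC.le).trans ?_
  have h2 := two_mul_abs_div_le hC.le hreg.abs_w_sub_le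
  have p1 : 0 < (n : ℝ) ^ (-(1 / 2) + ε) := Real.rpow_pos_of_pos hn0 _
  have p2 := hreg.η_pos
  calc _ ≤ (4 + Γ / 1) * (n : ℝ) ^ (-(1 / 2) + ε) +
        2 * ((1 + B * C) * (n : ℝ) ^ (δ - 1)) := add_le_add h1 h2
    _ = 2 * (1 + B * C) * (n : ℝ) ^ (δ - 1) + (4 + Γ / 1) * (n : ℝ) ^ (-(1 / 2) + ε) := by ring
    _ ≤ _ := by
      rw [mul_add (max _ _)]
      gcongr
      exacts [le_max_left _ _, le_max_right _ _]

theorem geomRatio_sq_lt_of_lt_critB {B C : ℝ} (hB : 0 < B) (hC : 0 < C) (hlt : B < critB C) :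
    geomRatio (B * C) ^ 2 < geomRatio C := by
  have hBC : 0 < B * C := mul_pos hB hC
  rw [← geomRatio_critB_sq hC]
  refine pow_lt_pow_left₀ ?_ (geomRatio_nonneg hBC.le) two_ne_zero
  unfold geomRatio
  have h1 : B * C < critB C * C := by gcongr
  rw [div_lt_div_iff₀ (by linarith) (by linarith)]
  linarith

/-- The asymptotics of the mean of the side blocks of the typical table. -/
theorem exists_side_mean_bound {B C : ℝ} (hB : 0 < B) (hC : 0 < C) (hne : B ≠ critB C) :
    ∃ K θ : ℝ, 0 < K ∧ 0 < θ ∧ ∀ η m n u v w, TypicalRegime (B * C) C η m n u v w → η ≤ θ →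
      |v - if B < critB C then B * C else critB C * C| ≤ K * η := by
  rcases lt_or_gt_of_ne hne with hlt | hgt
  · obtain ⟨hR, hRq⟩ := geomRatio_topLeft hB hC hlt
    obtain ⟨K, θ, hK, hθ, h⟩ := TypicalRegime.exists_subcritical_bound (mul_pos hB hC) hC
      (geomRatio_sq_lt_of_lt_critB hB hC hlt) hR.le hRq
    refine ⟨K, θ, hK, hθ, fun η m n u v w hreg hη => ?_⟩
    rw [if_pos hlt]
    exact (h η m n u v w hreg hη).1
  · obtain ⟨K, θ, hK, hθ, h⟩ := TypicalRegime.exists_supercritical_bound hC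
      (mul_pos (critB_pos C) hC) (mul_lt_mul_of_pos_right hgt hC) (geomRatio_critB_sq hC)
    refine ⟨K, θ, hK, hθ, fun η m n u v w hreg hη => ?_⟩
    rw [if_neg hgt.not_gt]
    exact (h η m n u v w hreg hη).1

/-- The side blocks. -/
theorem exists_dTV_side_bound {δ B C ε : ℝ} (hB : 0 < B) (hC : 0 < C) (hε : 0 < ε)
    (hδ : 0 ≤ δ) (hδ' : δ ≤ 1) (hne : B ≠ critB C) :
    ∃ K : ℝ, ∀ n : ℕ, 1 ≤ n → ∀ i j : Fin (numTop n δ + n),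
      ((i : ℕ) < numTop n δ ∧ numTop n δ ≤ (j : ℕ)) ∨
        (numTop n δ ≤ (i : ℕ) ∧ (j : ℕ) < numTop n δ) →
      dTV (entryMass n δ B C i j) (geomMass (if B < critB C then B * C else critB C * C)) ≤
        K * ((n : ℝ) ^ (δ - 1) + (n : ℝ) ^ (-(δ / 2) + ε)) := by
  have hR : 0 ≤ if B < critB C then B * C else critB C * C := by
    have := critB_pos C
    split_ifs <;> positivity
  generalize hRdef : (if B < critB C then B * C else critB C * C) = R at hR
  refine Exists.imp ?_ (exists_bound_of_eventually (e := -(δ / 2) + ε) hδ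
    (fun n x => ∃ i j : Fin (numTop n δ + n), (((i : ℕ) < numTop n δ ∧ numTop n δ ≤ (j : ℕ)) ∨
        (numTop n δ ≤ (i : ℕ) ∧ (j : ℕ) < numTop n δ)) ∧
      x = dTV (entryMass n δ B C i j) (geomMass R)) ?_ ?_)
  · exact fun K hK n hn i j hij => hK n _ hn ⟨i, j, hij, rfl⟩
  · rintro n x - ⟨i, j, -, rfl⟩
    exact dTV_entryMass_le_two n δ B C i j hR
  rcases hδ'.eq_or_lt with rfl | hδ1
  · refine ⟨2, 0, ?_⟩
    rintro n x - hn ⟨i, j, -, rfl⟩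
    refine (dTV_entryMass_le_two n 1 B C i j hR).trans ?_
    have : 0 < (n : ℝ) ^ (-(1 / 2 : ℝ) + ε) :=
      Real.rpow_pos_of_pos (by exact_mod_cast hn) _
    rw [sub_self, Real.rpow_zero]
    linarith
  obtain ⟨Γ, hΓ, n₀, h⟩ := exists_dTV_typical_bound hB hC hε
  obtain ⟨K, θ, hK0, hθ, hmean⟩ := exists_side_mean_bound hB hC hne
  obtain ⟨n₁, hn₁⟩ := exists_rpow_le (by linarith : δ - 1 < 0) hθ
  refine ⟨max (2 * K) (4 + Γ / (1 / 2)), n₀ + n₁, ?_⟩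
  rintro n x hn₀ hn ⟨i, j, hij, rfl⟩
  have hn0 : (0 : ℝ) < n := by exact_mod_cast hn
  obtain ⟨u, v, w, hreg, hbound⟩ := h δ hδ hδ' n (by omega) hn
  have hv := hmean _ _ _ u v w hreg (hn₁ n (by omega))
  rw [hRdef] at hv
  have hcard := (rpow_le_block_size hn hδ hδ').1
  have h1 : dTV (entryMass n δ B C i j) (geomMass v) ≤
      (4 + Γ / (1 / 2)) * (n : ℝ) ^ (-(δ / 2) + ε) := by
    rcases hij with ⟨hi, hj⟩ | ⟨hi, hj⟩
    · have h1 := hbound i j δ (1 / 2) (by norm_num) (by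
        rw [topLabel_eq_true hi, topLabel_eq_false hj]
        exact hcard)
      rwa [topLabel_eq_true hi, topLabel_eq_false hj] at h1
    · have h1 := hbound i j δ (1 / 2) (by norm_num) (by
        rw [topLabel_eq_false hi, topLabel_eq_true hj]
        exact hcard.trans (le_of_eq (mul_comm _ _)))
      rwa [topLabel_eq_false hi, topLabel_eq_true hj] at h1
  refine (dTV_entryMass_triangle n δ B C i j hreg.v_pos.le hR).trans ?_
  have h2 := two_mul_abs_div_le hR hv
  have p1 : 0 < (n : ℝ) ^ (-(δ / 2) + ε) := Real.rpow_pos_of_pos hn0 _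
  have p2 := hreg.η_pos
  calc _ ≤ (4 + Γ / (1 / 2)) * (n : ℝ) ^ (-(δ / 2) + ε) +
        2 * (K * (n : ℝ) ^ (δ - 1)) := add_le_add h1 h2
    _ = 2 * K * (n : ℝ) ^ (δ - 1) + (4 + Γ / (1 / 2)) * (n : ℝ) ^ (-(δ / 2) + ε) := by ring
    _ ≤ _ := by
      rw [mul_add]
      gcongr
      exacts [le_max_left _ _, le_max_right _ _]

/-- The top left block, given an estimate for the mean of the typical table. -/
theorem exists_dTV_topLeft_bound {δ B C ε : ℝ} (hB : 0 < B) (hC : 0 < C) (hε : 0 < ε)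
    (hδ : 0 ≤ δ) (hδ' : δ ≤ 1) (P : ℕ → ℝ → Prop) (hP : ∀ n R, P n R → 0 ≤ R)
    (hmean : ∃ K : ℝ, ∃ n₁ : ℕ, ∀ n : ℕ, n₁ ≤ n → 1 ≤ n → ∀ u v w R,
      TypicalRegime (B * C) C ((n : ℝ) ^ (δ - 1)) (numTop n δ) n u v w → P n R →
        2 * |u - R| / (1 + R) ≤ K * (n : ℝ) ^ (δ - 1)) :
    ∃ K : ℝ, ∀ n : ℕ, 1 ≤ n → ∀ R, P n R → ∀ i j : Fin (numTop n δ + n),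
      (i : ℕ) < numTop n δ → (j : ℕ) < numTop n δ →
      dTV (entryMass n δ B C i j) (geomMass R) ≤
        K * ((n : ℝ) ^ (δ - 1) + (n : ℝ) ^ (1 / 2 - δ + ε)) := by
  refine Exists.imp ?_ (exists_bound_of_eventually (e := 1 / 2 - δ + ε) hδ
    (fun n x => ∃ R, P n R ∧ ∃ i j : Fin (numTop n δ + n), (i : ℕ) < numTop n δ ∧
      (j : ℕ) < numTop n δ ∧ x = dTV (entryMass n δ B C i j) (geomMass R)) ?_ ?_)
  · exact fun K hK n hn R hR i j hi hj => hK n _ hn ⟨R, hR, i, j, hi, hj, rfl⟩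
  · rintro n x - ⟨R, hR, i, j, -, -, rfl⟩
    exact dTV_entryMass_le_two n δ B C i j (hP n R hR)
  obtain ⟨Γ, hΓ, n₀, h⟩ := exists_dTV_typical_bound hB hC hε
  obtain ⟨K, n₁, hmean⟩ := hmean
  refine ⟨max K (4 + Γ / (1 / 4)), n₀ + n₁, ?_⟩
  rintro n x hn₀ hn ⟨R, hR, i, j, hi, hj, rfl⟩
  have hn0 : (0 : ℝ) < n := by exact_mod_cast hn
  obtain ⟨u, v, w, hreg, hbound⟩ := h δ hδ hδ' n (by omega) hn
  have h2 := hmean n (by omega) hn u v w R hreg hR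
  have h1 := hbound i j (2 * δ - 1) (1 / 4) (by norm_num) (by
        rw [topLabel_eq_true hi, topLabel_eq_true hj]
        exact (rpow_le_block_size hn hδ hδ').2)
  rw [topLabel_eq_true hi, topLabel_eq_true hj,
    show -((2 * δ - 1) / 2) + ε = 1 / 2 - δ + ε by ring] at h1
  refine (dTV_entryMass_triangle n δ B C i j (z := u) hreg.u_pos.le (hP n R hR)).trans ?_
  have p1 : 0 < (n : ℝ) ^ (1 / 2 - δ + ε) := Real.rpow_pos_of_pos hn0 _
  have p2 := hreg.η_pos
  calc _ ≤ (4 + Γ / (1 / 4)) * (n : ℝ) ^ (1 / 2 - δ + ε) +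
        K * (n : ℝ) ^ (δ - 1) := add_le_add h1 h2
    _ = K * (n : ℝ) ^ (δ - 1) + (4 + Γ / (1 / 4)) * (n : ℝ) ^ (1 / 2 - δ + ε) := by ring
    _ ≤ _ := by
      rw [mul_add]
      gcongr
      exacts [le_max_left _ _, le_max_right _ _]

theorem exists_topLeft_mean_bound_of_lt {δ B C : ℝ} (hB : 0 < B) (hC : 0 < C) (hδ1 : δ < 1)
    (hlt : B < critB C) :
    ∃ K : ℝ, ∃ n₁ : ℕ, ∀ n : ℕ, n₁ ≤ n → 1 ≤ n → ∀ u v w R,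
      TypicalRegime (B * C) C ((n : ℝ) ^ (δ - 1)) (numTop n δ) n u v w →
        R = B ^ 2 * (1 + C) / ((critB C - B) * (B + critB C - 2)) →
        2 * |u - R| / (1 + R) ≤ K * (n : ℝ) ^ (δ - 1) := by
  obtain ⟨hR, hRq⟩ := geomRatio_topLeft hB hC hlt
  obtain ⟨K, θ, hK, hθ, h⟩ := TypicalRegime.exists_subcritical_bound (mul_pos hB hC) hC
    (geomRatio_sq_lt_of_lt_critB hB hC hlt) hR.le hRq
  obtain ⟨n₁, hn₁⟩ := exists_rpow_le (by linarith : δ - 1 < 0) hθ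
  refine ⟨2 * K, n₁, ?_⟩
  rintro n hn₁' hn u v w R hreg rfl
  have := two_mul_abs_div_le hR.le (h _ _ _ u v w hreg (hn₁ n hn₁')).2
  linarith

theorem exists_topLeft_mean_bound_of_gt {δ B C : ℝ} (hC : 0 < C) (hδ : 1 / 2 < δ) (hδ1 : δ < 1)
    (hgt : critB C < B) (M : ℝ) :
    ∃ K : ℝ, ∃ n₁ : ℕ, ∀ n : ℕ, n₁ ≤ n → 1 ≤ n → ∀ u v w R,
      TypicalRegime (B * C) C ((n : ℝ) ^ (δ - 1)) (numTop n δ) n u v w →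
        (0 < R ∧ |R - C * (B - critB C) * (n : ℝ) ^ (1 - δ)| ≤ M) →
        2 * |u - R| / (1 + R) ≤ K * (n : ℝ) ^ (δ - 1) := by
  obtain ⟨K, θ, hK, hθ, h⟩ := TypicalRegime.exists_supercritical_bound hC
    (mul_pos (critB_pos C) hC) (mul_lt_mul_of_pos_right hgt hC) (geomRatio_critB_sq hC)
  set d := C * (B - critB C) with hd
  have hd0 : 0 < d := mul_pos hC (sub_pos.mpr hgt)
  obtain ⟨n₁, hn₁⟩ := exists_rpow_le (by linarith : δ - 1 < 0)
    (lt_min hθ (by positivity : 0 < d / (2 * (|M| + 1))))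
  refine ⟨4 * (K + |M|) / d, n₁, ?_⟩
  rintro n hn₁' hn u v w R hreg ⟨hR, hRM⟩
  have hn0 : (0 : ℝ) < n := by exact_mod_cast hn
  have hn' : (1 : ℝ) ≤ n := by exact_mod_cast hn
  have hη := hn₁ n hn₁'
  have hinv : (n : ℝ) ^ (1 - δ) = 1 / (n : ℝ) ^ (δ - 1) := by
    rw [show 1 - δ = -(δ - 1) by ring, Real.rpow_neg hn0.le, one_div]
  have hnη : 1 ≤ (n : ℝ) * ((n : ℝ) ^ (δ - 1)) ^ 2 := by
    have : (n : ℝ) * ((n : ℝ) ^ (δ - 1)) ^ 2 = (n : ℝ) ^ (2 * δ - 1) := by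
      rw [← Real.rpow_natCast, ← Real.rpow_mul hn0.le]
      nth_rewrite 1 [← Real.rpow_one (n : ℝ)]
      rw [← Real.rpow_add hn0]
      congr 1
      push_cast
      ring
    rw [this]
    exact Real.one_le_rpow hn' (by linarith)
  have hu := (h _ _ _ u v w hreg (hη.trans (min_le_left _ _))).2 hnη
  have hη0 := hreg.η_pos
  have hη2 := hη.trans (min_le_right _ _)
  set η := (n : ℝ) ^ (δ - 1) with hηdef
  rw [show B * C - critB C * C = d by rw [hd]; ring] at hu
  rw [hinv, mul_one_div] at hRM
  rw [le_div_iff₀ (by positivity)] at hη2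
  have hdη : 2 * (|M| + 1) ≤ d / η := by
    rw [le_div_iff₀ hη0]; linarith
  have hRlow : d / η / 2 ≤ R := by
    have h1 := (abs_le.mp hRM).1
    have h2 := le_abs_self M
    linarith [abs_nonneg M]
  have huR : |u - R| ≤ K + |M| := by
    have h1 := abs_sub_le u (d / η) R
    rw [abs_sub_comm (d / η) R] at h1
    linarith [le_abs_self M]
  have hKM : 0 ≤ K + |M| := by positivity
  calc 2 * |u - R| / (1 + R) ≤ 2 * (K + |M|) / (d / η / 2) := by
        gcongr
        linarith
    _ = _ := by field_simp; ring

end ContingencyTable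

end

theorem theorem1 (δ B C ε : ℝ) (hB : 0 < B) (hC : 0 < C) (hε : 0 < ε) :
    -- bottom right block
    (0 ≤ δ → δ ≤ 1 →
      ∃ K : ℝ, ∀ n : ℕ, 1 ≤ n → ∀ i j : Fin (ContingencyTable.numTop n δ + n),
        ContingencyTable.numTop n δ ≤ (i : ℕ) → ContingencyTable.numTop n δ ≤ (j : ℕ) →
        ContingencyTable.dTV (ContingencyTable.entryMass n δ B C i j)
            (ContingencyTable.geomMass C) ≤
          K * ((n : ℝ) ^ (δ - 1) + (n : ℝ) ^ (-(1 / 2) + ε))) ∧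
    -- side blocks
    (0 < δ → δ ≤ 1 → B ≠ ContingencyTable.critB C →
      ∃ K : ℝ, ∀ n : ℕ, 1 ≤ n → ∀ i j : Fin (ContingencyTable.numTop n δ + n),
        ((i : ℕ) < ContingencyTable.numTop n δ ∧ ContingencyTable.numTop n δ ≤ (j : ℕ)) ∨
          (ContingencyTable.numTop n δ ≤ (i : ℕ) ∧ (j : ℕ) < ContingencyTable.numTop n δ) →
        ContingencyTable.dTV (ContingencyTable.entryMass n δ B C i j)
            (ContingencyTable.geomMass
              (if B < ContingencyTable.critB C then B * C
                else ContingencyTable.critB C * C)) ≤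
          K * ((n : ℝ) ^ (δ - 1) + (n : ℝ) ^ (-(δ / 2) + ε))) ∧
    -- top left block, subcritical case
    (1 / 2 < δ → δ < 1 → B < ContingencyTable.critB C →
      ∃ K : ℝ, ∀ n : ℕ, 1 ≤ n → ∀ i j : Fin (ContingencyTable.numTop n δ + n),
        (i : ℕ) < ContingencyTable.numTop n δ → (j : ℕ) < ContingencyTable.numTop n δ →
        ContingencyTable.dTV (ContingencyTable.entryMass n δ B C i j)
            (ContingencyTable.geomMass
              (B ^ 2 * (1 + C) /
                ((ContingencyTable.critB C - B) * (B + ContingencyTable.critB C - 2)))) ≤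
          K * ((n : ℝ) ^ (δ - 1) + (n : ℝ) ^ (1 / 2 - δ + ε))) ∧
    -- top left block, supercritical case: every mean `R = C (B - B_c) n ^ (1 - δ) + O(1)`
    (1 / 2 < δ → δ < 1 → ContingencyTable.critB C < B →
      ∀ M : ℝ, ∃ K : ℝ, ∀ n : ℕ, 1 ≤ n → ∀ R : ℝ, 0 < R →
        |R - C * (B - ContingencyTable.critB C) * (n : ℝ) ^ (1 - δ)| ≤ M →
        ∀ i j : Fin (ContingencyTable.numTop n δ + n),
        (i : ℕ) < ContingencyTable.numTop n δ → (j : ℕ) < ContingencyTable.numTop n δ →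
        ContingencyTable.dTV (ContingencyTable.entryMass n δ B C i j)
            (ContingencyTable.geomMass R) ≤
          K * ((n : ℝ) ^ (δ - 1) + (n : ℝ) ^ (1 / 2 - δ + ε))) := by
  refine ⟨fun hδ hδ' => ContingencyTable.exists_dTV_bottomRight_bound hB hC hε hδ hδ',
    fun hδ hδ' hne => ContingencyTable.exists_dTV_side_bound hB hC hε hδ.le hδ' hne,
    fun hδ hδ' hlt => ?_, fun hδ hδ' hgt M => ?_⟩
  · obtain ⟨hR, -⟩ := ContingencyTable.geomRatio_topLeft hB hC hlt
    obtain ⟨K, hK⟩ := ContingencyTable.exists_dTV_topLeft_bound hB hC hε (by linarith) hδ'.le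
      (fun _ R => R = B ^ 2 * (1 + C) /
        ((ContingencyTable.critB C - B) * (B + ContingencyTable.critB C - 2)))
      (fun _ R h => h ▸ hR.le)
      (ContingencyTable.exists_topLeft_mean_bound_of_lt hB hC hδ' hlt)
    exact ⟨K, fun n hn => hK n hn _ rfl⟩
  · obtain ⟨K, hK⟩ := ContingencyTable.exists_dTV_topLeft_bound hB hC hε (by linarith) hδ'.le
      (fun n R => 0 < R ∧
        |R - C * (B - ContingencyTable.critB C) * (n : ℝ) ^ (1 - δ)| ≤ M)
      (fun _ R h => h.1.le)
      (ContingencyTable.exists_topLeft_mean_bound_of_gt hC hδ hδ' hgt M)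
    exact ⟨K, fun n hn R hR hRM => hK n hn R ⟨hR, hRM⟩⟩
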